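/- Let $n, K$ be integers, $n\ge 0$, $K\ge 2$, and let $\Omega=\mathbb T^n=(\mathbb R/2\pi\mathbb Z)^n$ with Lebesgue measure. Let $a:\Omega\to\mathbb R$ satisfy $a\ge C$ on $\Omega$ for some constant $C>0$. Let $J=\{0,\dots,K-1\}^n$; for $j\in J$ let $x_j=\frac{2\pi}{K}j$ and let $D_j\subset\Omega$ be the open cube with centre $x_j$ and side length $\frac{4\pi}{K}$. Let $g_j$ $(j\in J)$ be real-valued functions in $C^\infty(\Omega)$ with $\operatorname{supp} g_j\subset D_j$ and $\sum_{j\in J}g_j^2=1$ on $\Omega$. For $k\in\mathbb Z^n$ put $\xi_k=\frac K2 k$, identify $D_j$ with a cube in $\mathbb R^n$, and let $\mathcal F_{D_j}v=\big(\big(\tfrac{4\pi}{K}\big)^{-n}\int_{D_j}v(x)e^{-i\xi_k\cdot x}\,dx\big)_{k\in\mathbb Z^n}$ be the Fourier transform $L^2(D_j)\to\ell^2(\mathbb Z^n)$, with inverse $(c_k)\mapsto\sum_k c_k e^{i\xi_k\cdot x}$. Let $S_j=\mathcal F_{D_j}^{-1}M_{1/2}\mathcal F_{D_j}$ on $L^2(D_j)$,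 where $M_{1/2}$ multiplies the $k$-th entry by $(1+a(x_j)|\xi_k|^2)^{-1/2}$, and define on $L^2(\Omega)$ (complex-valued functions) the operator $$P=\sum_{j\in J}g_j\,S_j\,g_j .$$ Let $H^1(\Omega)$ be the space of all $\psi\in L^2(\Omega)$ with $\|\psi\|_{H^1}^2=\sum_{m\in\mathbb Z^n}(1+|m|^2)|a_m|^2<\infty$, where $a_m=(2\pi)^{-n}\int_\Omega\psi(x)e^{-im\cdot x}\,dx$. Then $P$ is a linear bijection from $L^2(\Omega)$ onto $H^1(\Omega)$, and there are constants $0<A\le B$ such that $$A\,\|Pu\|_{H^1}\le\|u\|_{L^2}\le B\,\|Pu\|_{H^1}\qquad\text{for every }u\in L^2(\Omega).$$ -/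

import Mathlib

open MeasureTheory
open scoped Real ENNReal ContDiff

noncomputable section

namespace WindowedFourier

instance twoPiPos : Fact ((0 : ℝ) < 2 * π) := ⟨Real.two_pi_pos⟩

/-- The torus `𝕋ⁿ = (ℝ / 2πℤ)ⁿ`.  Its `volume` is Lebesgue measure on `[0, 2π)ⁿ`,
of total mass `(2π)ⁿ`. -/
abbrev Torus (n : ℕ) : Type := Fin n → AddCircle (2 * π)

/-- The complex Hilbert space `L²(𝕋ⁿ)`. -/
abbrev L2 (n : ℕ) : Type := Lp ℂ 2 (volume : Measure (Torus n))

/-! ### Fourier coefficients and the Sobolev space `H¹(𝕋ⁿ)` -/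

/-- The exponential `x ↦ e^{i m·x}` on `𝕋ⁿ`, for `m ∈ ℤⁿ`. -/
def torusMode {n : ℕ} (m : Fin n → ℤ) : C(Torus n, ℂ) where
  toFun x := ∏ i, fourier (m i) (x i)
  continuous_toFun := by fun_prop

/-- The Fourier coefficient `a_m = (2π)⁻ⁿ ∫ u(x) e^{-i m·x} dx` of `u ∈ L²(𝕋ⁿ)`. -/
def fourierCoefficient {n : ℕ} (u : L2 n) (m : Fin n → ℤ) : ℂ :=
  (((2 * π) ^ n : ℝ) : ℂ)⁻¹ * inner ℂ (ContinuousMap.toLp 2 volume ℂ (torusMode m)) u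

/-- The weight `1 + |m|²`, with `|m|` the Euclidean norm of `m ∈ ℤⁿ`. -/
def h1Weight {n : ℕ} (m : Fin n → ℤ) : ℝ := 1 + ∑ i, (m i : ℝ) ^ 2

lemma h1Weight_nonneg {n : ℕ} (m : Fin n → ℤ) : 0 ≤ h1Weight m := by
  unfold h1Weight; positivity

/-- The Sobolev space `H¹(𝕋ⁿ)`, as a linear subspace of `L²(𝕋ⁿ)`: the functions with
`∑ₘ (1 + |m|²) |a_m|² < ∞`. -/
def H1 (n : ℕ) : Submodule ℂ (L2 n) where
  carrier := {u | Summable fun m : Fin n → ℤ => h1Weight m * ‖fourierCoefficient u m‖ ^ 2}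
  zero_mem' := by simp [fourierCoefficient, summable_zero]
  add_mem' := by
    intro u v hu hv
    refine Summable.of_nonneg_of_le
      (fun m => mul_nonneg (h1Weight_nonneg m) (by positivity)) (fun m => ?_)
      ((hu.add hv).mul_left 2)
    have h1 : fourierCoefficient (u + v) m = fourierCoefficient u m + fourierCoefficient v m := by
      simp only [fourierCoefficient, inner_add_right, mul_add]
    have h2 := norm_add_le (fourierCoefficient u m) (fourierCoefficient v m)
    have h3 : ‖fourierCoefficient (u + v) m‖ ^ 2 ≤
        2 * (‖fourierCoefficient u m‖ ^ 2 + ‖fourierCoefficient v m‖ ^ 2) := by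
      rw [h1]
      refine (pow_le_pow_left₀ (norm_nonneg _) h2 2).trans ?_
      nlinarith [sq_nonneg (‖fourierCoefficient u m‖ - ‖fourierCoefficient v m‖)]
    nlinarith [mul_le_mul_of_nonneg_left h3 (h1Weight_nonneg m)]
  smul_mem' := by
    intro c u hu
    refine (hu.mul_left (‖c‖ ^ 2)).congr (fun m => ?_)
    have h1 : fourierCoefficient (c • u) m = c * fourierCoefficient u m := by
      simp only [fourierCoefficient, inner_smul_right]; ring
    rw [h1, norm_mul]; ring

/-- The norm of `H¹(𝕋ⁿ)`: `‖u‖₁ = (∑ₘ (1 + |m|²) |a_m|²)^{1/2}`. -/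
def h1Norm {n : ℕ} (u : H1 n) : ℝ :=
  √(∑' m : Fin n → ℤ, h1Weight m * ‖fourierCoefficient (u : L2 n) m‖ ^ 2)

/-! ### The overlapping blocks and the windows -/

/-- The coordinates `2π jᵢ / K` of the midpoint of the `j`-th block. -/
def centerCoord {n K : ℕ} (j : Fin n → Fin K) (i : Fin n) : ℝ :=
  2 * π / K * ((j i : ℕ) : ℝ)

/-- The midpoint `x_j ∈ 𝕋ⁿ` of the `j`-th block. -/
def center {n K : ℕ} (j : Fin n → Fin K) : Torus n :=
  fun i => ((centerCoord j i : ℝ) : AddCircle (2 * π))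

/-- The (open) block `D_j`, the cube of side `4π / K` around `x_j`; the norm of `AddCircle (2π)`
is the distance to `0` on the circle. -/
def block {n K : ℕ} (j : Fin n → Fin K) : Set (Torus n) :=
  {x | ∀ i, ‖x i - center j i‖ < 2 * π / K}

/-- The representative in `[2π jᵢ / K - π, 2π jᵢ / K + π)` of the `i`-th coordinate of `x`.  For
`K ≥ 2` this identifies `D_j` with the open cube of side `4π / K` around `(2π jᵢ / K)ᵢ` in `ℝⁿ`. -/
def lift {n K : ℕ} (j : Fin n → Fin K) (x : Torus n) (i : Fin n) : ℝ :=
  (AddCircle.equivIco (2 * π) (centerCoord j i - π) (x i) : ℝ)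

lemma measurable_lift {n K : ℕ} (j : Fin n → Fin K) (i : Fin n) :
    Measurable (fun x : Torus n => lift j x i) :=
  (measurable_subtype_coe.comp
    (AddCircle.measurableEquivIco (2 * π) (centerCoord j i - π)).measurable).comp
    (measurable_pi_apply i)

/-- A family of windows `g_j`, one for each of the `Kⁿ` blocks: real-valued smooth functions on the
torus with compact support inside the block `D_j` and `∑ⱼ g_j² = 1`. -/
structure WindowFamily (n K : ℕ) where
  /-- the `j`-th window -/
  g : (Fin n → Fin K) → C(Torus n, ℝ)
  smooth : ∀ j, ContDiff ℝ ∞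
    (fun x : Fin n → ℝ => g j (fun i => ((x i : ℝ) : AddCircle (2 * π))))
  support_subset : ∀ j, tsupport (g j) ⊆ block j
  sum_sq : ∀ x, ∑ j, g j x ^ 2 = 1

/-! ### The Fourier transform on a block -/

/-- The Hilbert space `L²(D_j)`. -/
abbrev L2Block {n K : ℕ} (j : Fin n → Fin K) : Type :=
  Lp ℂ 2 ((volume : Measure (Torus n)).restrict (block j))

/-- The frequencies `ξ_k = (K / 2) k`, `k ∈ ℤⁿ`, of the functions of period `4π / K`. -/
def freq {n : ℕ} (K : ℕ) (k : Fin n → ℤ) (i : Fin n) : ℝ := K / 2 * (k i : ℝ)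

/-- The exponential `x ↦ e^{i ξ_k·x}` on `D_j`. -/
def blockModeFun {n K : ℕ} (j : Fin n → Fin K) (k : Fin n → ℤ) (x : Torus n) : ℂ :=
  Complex.exp (Complex.I * ((∑ i, freq K k i * lift j x i : ℝ) : ℂ))

lemma memLp_blockModeFun {n K : ℕ} (j : Fin n → Fin K) (k : Fin n → ℤ) :
    MemLp (blockModeFun j k) 2 ((volume : Measure (Torus n)).restrict (block j)) := by
  refine MemLp.of_bound (C := 1) (Measurable.aestronglyMeasurable ?_) (ae_of_all _ fun x => ?_)
  · have h : Measurable fun x : Torus n => ∑ i, freq K k i * lift j x i :=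
      Finset.measurable_sum _ fun i _ => (measurable_lift j i).const_mul _
    exact Complex.measurable_exp.comp ((Complex.measurable_ofReal.comp h).const_mul _)
  · rw [blockModeFun, mul_comm, Complex.norm_exp_ofReal_mul_I]

/-- The exponential `e^{i ξ_k·x}` as an element of `L²(D_j)`. -/
def blockMode {n K : ℕ} (j : Fin n → Fin K) (k : Fin n → ℤ) : L2Block j :=
  (memLp_blockModeFun j k).toLp _

/-- The Fourier transform `𝓕_{D_j}` on `D_j`:
`(𝓕_{D_j} v)_k = (4π / K)⁻ⁿ ∫_{D_j} v(x) e^{-i ξ_k·x} dx`. -/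
def blockFourier {n K : ℕ} (j : Fin n → Fin K) (v : L2Block j) (k : Fin n → ℤ) : ℂ :=
  (((4 * π / K) ^ n : ℝ) : ℂ)⁻¹ * inner ℂ (blockMode j k) v

/-- The inverse Fourier transform on `D_j`: `c ↦ ∑ₖ c_k e^{i ξ_k·x}`, the series being taken in
`L²(D_j)`; it converges for every square summable `c`. -/
def blockFourierInv {n K : ℕ} (j : Fin n → Fin K) (c : (Fin n → ℤ) → ℂ) : L2Block j :=
  ∑' k, c k • blockMode j k

/-- The diagonal entries `(1 + a(x_j) |ξ_k|²)^{-1/2}` of `M^{-1/2}`. -/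
def symbolInvSqrt {n K : ℕ} (a : Torus n → ℝ) (j : Fin n → Fin K) (k : Fin n → ℤ) : ℝ :=
  (1 + a (center j) * ∑ i, freq K k i ^ 2) ^ (-(1 / 2) : ℝ)

/-- The operator `S_j = 𝓕_{D_j}⁻¹ M^{-1/2} 𝓕_{D_j}` on `L²(D_j)`. -/
def blockOperator {n K : ℕ} (a : Torus n → ℝ) (j : Fin n → Fin K) (v : L2Block j) : L2Block j :=
  blockFourierInv j fun k => (symbolInvSqrt a j k : ℂ) * blockFourier j v k

/-! ### The windowing operator and the operator `P` -/

/-- Multiplication by a continuous real-valued function, on `L²(𝕋ⁿ)`. -/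
def mulOperator {n : ℕ} (g : C(Torus n, ℝ)) : L2 n →L[ℂ] L2 n :=
  (ContinuousLinearMap.mul ℂ ℂ).holderL volume ∞ 2 2
    (ContinuousMap.toLp ∞ volume ℂ ((⟨Complex.ofReal, Complex.continuous_ofReal⟩ : C(ℝ, ℂ)).comp g))

/-- The `j`-th component `L²(𝕋ⁿ) → L²(D_j)`, `u ↦ (g_j u)|_{D_j}`, of the windowing operator `W`. -/
def windowing {n K : ℕ} (w : WindowFamily n K) (j : Fin n → Fin K) : L2 n →L[ℂ] L2Block j :=
  (LpToLpRestrictCLM (Torus n) ℂ ℂ volume 2 (block j)).comp (mulOperator (w.g j))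

lemma windowing_coeFn {n K : ℕ} (w : WindowFamily n K) (j : Fin n → Fin K) (u : L2 n) :
    windowing w j u =ᵐ[(volume : Measure (Torus n)).restrict (block j)]
      fun x => (w.g j x : ℂ) * u x := by
  refine (LpToLpRestrictCLM_coeFn ℂ (block j) (mulOperator (w.g j) u)).trans
    (ae_restrict_of_ae ?_)
  have h1 := (ContinuousLinearMap.mul ℂ ℂ).coeFn_holder (r := 2) (ContinuousMap.toLp ∞ volume ℂ
    ((⟨Complex.ofReal, Complex.continuous_ofReal⟩ : C(ℝ, ℂ)).comp (w.g j))) u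
  have h2 := ContinuousMap.coeFn_toLp (p := ∞) (𝕜 := ℂ) (volume : Measure (Torus n))
    ((⟨Complex.ofReal, Complex.continuous_ofReal⟩ : C(ℝ, ℂ)).comp (w.g j))
  filter_upwards [h1, h2] with x hx1 hx2
  refine hx1.trans ?_
  rw [hx2]
  rfl

/-- The operator `P = ∑ⱼ g_j 𝓕_{D_j}⁻¹ M^{-1/2} 𝓕_{D_j} g_j` on `L²(𝕋ⁿ)`.  The adjoint of
`windowing w j` maps `v ∈ L²(D_j)` to `g_j v`, extended by zero outside `D_j`. -/
def P {n K : ℕ} (a : Torus n → ℝ) (w : WindowFamily n K) (u : L2 n) : L2 n :=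
  ∑ j, (windowing w j).adjoint (blockOperator a j (windowing w j u))

end WindowedFourier

end

/-!
The operator `P` has order `-1`, and its principal symbol `∑ⱼ a(x_j)^{-1/2} g_j(x)² / |ξ|` is
elliptic.  The proof makes this precise with matrices in Fourier bases only; no derivatives of `L²`
functions and no pseudodifferential calculus occur.

Let `W_j u = (g_j u)|_{D_j}` and write its adjoint as a matrix `E_{mk}` between the exponentials
`e^{i ξ_k·x}` of the block `D_j` and the exponentials `e^{i m·x}` of the torus.  Since `g_j` is smooth
with compact support in `D_j`, the entry `E_{mk}` is the Fourier transform of a function in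
`C_c^∞(ℝⁿ)` at `m - ξ_k`, hence decays rapidly in `m - ξ_k` (`inner_windowing_torusMode_blockMode`,
`exists_decay_integral_window`).  The symbols `μ_m = (1 + a(x_j) |m|²)^{1/2}` and
`λ_k = (1 + a(x_j) |ξ_k|²)^{1/2}` are values of one Lipschitz function, so by the Schur test the
matrix `(μ_m - λ_k) E_{mk}` is a bounded operator `Z_j` (`exists_clm_symbol_sub`).  This gives
`μ W_j* S_j = W_j* + Z_j S_j`, where `μ` acts as a Fourier multiplier.

Put `Λ = (1 + |m|²)^{1/2}`, a Fourier multiplier on the torus.  As `Λ / μ` differs from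
`a(x_j)^{-1/2}` by a sequence tending to zero and `S_j` is compact,
`Λ P = ∑ⱼ a(x_j)^{-1/2} W_j* W_j + compact`.  The sum is invertible because `∑ⱼ W_j* W_j = 1`, and
`Λ P` is injective because `⟨P u, u⟩ = ∑ⱼ ⟨S_j W_j u, W_j u⟩` vanishes only for `u = 0`.  The Fredholm
alternative shows that `Λ P` is an automorphism of `L²` (`exists_equiv_repr_eq_mul_repr`).  Since `Λ`
maps `H¹` onto `L²` and turns the `H¹` norm into a multiple of the `L²` norm, the theorem follows.

Completeness of the exponentials on the torus and on the blocks is carried over from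
`UnitAddTorus.mFourierBasis` along maps that preserve measures up to a constant factor
(`exists_hilbertBasis_of_measurePreserving`).
-/

/-! ### The Schur test and diagonal operators in Hilbert bases -/

/-- The Cauchy–Schwarz inequality for a weighted sum with total weight at most `C`. -/
lemma tsum_mul_sq_le_of_tsum_le {κ : Type*} {a c : κ → ℝ} {C : ℝ} (hC : 0 < C)
    (ha0 : ∀ k, 0 ≤ a k) (ha : Summable a) (haC : ∑' k, a k ≤ C)
    (hac : Summable fun k => a k * c k) (hac2 : Summable fun k => a k * c k ^ 2) :
    (∑' k, a k * c k) ^ 2 ≤ C * ∑' k, a k * c k ^ 2 := by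
  set L := ∑' k, a k * c k with hL
  -- the variance of `c` around the approximate mean `L / C` is nonnegative
  have h0 : 0 ≤ ∑' k, a k * (c k - L / C) ^ 2 :=
    tsum_nonneg fun k => mul_nonneg (ha0 k) (sq_nonneg _)
  have h1 : ∑' k, a k * (c k - L / C) ^ 2 =
      ∑' k, a k * c k ^ 2 - 2 * (L / C) * L + (L / C) ^ 2 * ∑' k, a k := by
    rw [hL, ← tsum_mul_left, ← tsum_mul_left, ← hL,
      ← hac2.tsum_sub (hac.mul_left _), ← (hac2.sub (hac.mul_left _)).tsum_add (ha.mul_left _)]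
    exact tsum_congr fun k => by ring
  have h2 : (L / C) ^ 2 * ∑' k, a k ≤ (L / C) ^ 2 * C :=
    mul_le_mul_of_nonneg_left haC (sq_nonneg _)
  have h3 : L ^ 2 / C ≤ ∑' k, a k * c k ^ 2 := by
    have : (L / C) ^ 2 * C = L ^ 2 / C := by field_simp
    have h4 : 2 * (L / C) * L = 2 * (L ^ 2 / C) := by ring
    linarith
  rw [div_le_iff₀ hC] at h3
  linarith

section HilbertBasis

variable {H₁ H₂ : Type*} [NormedAddCommGroup H₁] [InnerProductSpace ℂ H₁]
  [NormedAddCommGroup H₂] [InnerProductSpace ℂ H₂] {ι κ : Type*}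

lemma HilbertBasis.hasSum_norm_repr_sq (b : HilbertBasis κ ℂ H₁) (v : H₁) :
    HasSum (fun k => ‖b.repr v k‖ ^ 2) (‖v‖ ^ 2) := by
  have h := lp.hasSum_norm (p := 2) (by norm_num) (b.repr v)
  simpa [b.repr.norm_map] using h

/-- The **Schur test**: a matrix whose rows and columns are absolutely summable with sums at most
`C` defines an operator of norm at most `C`. -/
theorem HilbertBasis.exists_clm_of_schur (b : HilbertBasis κ ℂ H₁) (f : HilbertBasis ι ℂ H₂)
    (A : ι → κ → ℂ) {C : ℝ} (hC : 0 < C)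
    (hr : ∀ i, Summable fun k => ‖A i k‖) (hrC : ∀ i, ∑' k, ‖A i k‖ ≤ C)
    (hc : ∀ k, Summable fun i => ‖A i k‖) (hcC : ∀ k, ∑' i, ‖A i k‖ ≤ C) :
    ∃ Z : H₁ →L[ℂ] H₂, ∀ v i, HasSum (fun k => A i k * b.repr v k) (f.repr (Z v) i) := by
  have hbd : ∀ v k, ‖b.repr v k‖ ≤ ‖v‖ := fun v k => by
    simpa [b.repr.norm_map] using lp.norm_apply_le_norm (p := 2) (by norm_num) (b.repr v) k
  have hs1 : ∀ v i, Summable fun k => ‖A i k‖ * ‖b.repr v k‖ := fun v i =>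
    Summable.of_nonneg_of_le (fun k => by positivity)
      (fun k => mul_le_mul_of_nonneg_left (hbd v k) (norm_nonneg _)) ((hr i).mul_right ‖v‖)
  have hs : ∀ v i, Summable fun k => A i k * b.repr v k := fun v i =>
    Summable.of_norm (by simpa only [norm_mul] using hs1 v i)
  have hs2 : ∀ v i, Summable fun k => ‖A i k‖ * ‖b.repr v k‖ ^ 2 := fun v i =>
    Summable.of_nonneg_of_le (fun k => by positivity)
      (fun k => mul_le_mul_of_nonneg_left (pow_le_pow_left₀ (norm_nonneg _) (hbd v k) 2)
        (norm_nonneg _)) ((hr i).mul_right (‖v‖ ^ 2))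
  have hrow : ∀ v i, ‖∑' k, A i k * b.repr v k‖ ^ 2 ≤ C * ∑' k, ‖A i k‖ * ‖b.repr v k‖ ^ 2 := by
    intro v i
    have h1 : ‖∑' k, A i k * b.repr v k‖ ≤ ∑' k, ‖A i k‖ * ‖b.repr v k‖ := by
      have := norm_tsum_le_tsum_norm (f := fun k => A i k * b.repr v k)
        (by simpa only [norm_mul] using hs1 v i)
      simpa only [norm_mul] using this
    exact (pow_le_pow_left₀ (norm_nonneg _) h1 2).trans
      (tsum_mul_sq_le_of_tsum_le hC (fun _ => norm_nonneg _) (hr i) (hrC i) (hs1 v i) (hs2 v i))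
  have hfin : ∀ v (s : Finset ι),
      ∑ i ∈ s, ‖∑' k, A i k * b.repr v k‖ ^ 2 ≤ (C * ‖v‖) ^ 2 := by
    intro v s
    have hv := b.hasSum_norm_repr_sq v
    calc ∑ i ∈ s, ‖∑' k, A i k * b.repr v k‖ ^ 2
        ≤ ∑ i ∈ s, C * ∑' k, ‖A i k‖ * ‖b.repr v k‖ ^ 2 := Finset.sum_le_sum fun i _ => hrow v i
      _ = C * ∑' k, ∑ i ∈ s, ‖A i k‖ * ‖b.repr v k‖ ^ 2 := by
          rw [← Finset.mul_sum, Summable.tsum_finsetSum fun i _ => hs2 v i]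
      _ ≤ C * ∑' k, C * ‖b.repr v k‖ ^ 2 := by
          refine mul_le_mul_of_nonneg_left (Summable.tsum_le_tsum (fun k => ?_)
            (summable_sum fun i _ => hs2 v i) (hv.summable.mul_left C)) hC.le
          rw [← Finset.sum_mul]
          exact mul_le_mul_of_nonneg_right
            (((hc k).sum_le_tsum s fun _ _ => norm_nonneg _).trans (hcC k)) (by positivity)
      _ = (C * ‖v‖) ^ 2 := by rw [tsum_mul_left, hv.tsum_eq]; ring
  have hmem : ∀ v, Memℓp (fun i => ∑' k, A i k * b.repr v k) 2 := fun v =>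
    memℓp_gen' (C := (C * ‖v‖) ^ 2) fun s => by simpa using hfin v s
  let Z₀ : H₁ →ₗ[ℂ] H₂ :=
    { toFun := fun v => f.repr.symm ⟨_, hmem v⟩
      map_add' := fun u v => by
        rw [← map_add]
        congr 1
        ext i
        simp only [map_add, lp.coeFn_add, Pi.add_apply, mul_add]
        exact (hs u i).tsum_add (hs v i)
      map_smul' := fun c v => by
        rw [RingHom.id_apply, ← map_smul]
        congr 1
        ext i
        simp only [map_smul, lp.coeFn_smul, Pi.smul_apply, smul_eq_mul]
        rw [← tsum_mul_left]
        exact tsum_congr fun k => by ring }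
  refine ⟨Z₀.mkContinuous C fun v => ?_, fun v i => ?_⟩
  · change ‖f.repr.symm _‖ ≤ _
    rw [LinearIsometryEquiv.norm_map]
    exact lp.norm_le_of_forall_sum_le (by norm_num) (by positivity)
      fun s => by simpa using hfin v s
  · have : f.repr (Z₀ v) = ⟨_, hmem v⟩ := f.repr.apply_symm_apply _
    rw [LinearMap.mkContinuous_apply, this]
    exact (hs v i).hasSum

/-- The operator multiplying the coordinates in a Hilbert basis by a bounded sequence. -/
theorem HilbertBasis.exists_diagonal (b : HilbertBasis κ ℂ H₁) (σ : κ → ℂ) {C : ℝ}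
    (hσ : ∀ k, ‖σ k‖ ≤ C) :
    ∃ S : H₁ →L[ℂ] H₁, ∀ v k, b.repr (S v) k = σ k * b.repr v k := by
  classical
  have hs : ∀ i k, i ≠ k → ‖if i = k then σ i else 0‖ = 0 := fun i k h => by simp [h]
  have hle : ∀ k, ‖if k = k then σ k else 0‖ ≤ max C 1 := fun k => by
    simpa using Or.inl (hσ k)
  obtain ⟨S, hS⟩ := b.exists_clm_of_schur b (fun i k => if i = k then σ i else 0)
    (C := max C 1) (by positivity)
    (fun i => (hasSum_single i fun k h => hs i k h.symm).summable)
    (fun i => by rw [tsum_eq_single i fun k h => hs i k h.symm]; exact hle i)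
    (fun k => (hasSum_single k fun i h => hs i k h).summable)
    (fun k => by rw [tsum_eq_single k fun i h => hs i k h]; exact hle k)
  refine ⟨S, fun v k => (hS v k).unique ?_⟩
  have := hasSum_single (f := fun i => (if k = i then σ k else 0) * b.repr v i) k
    fun i h => by simp [h.symm]
  simpa using this

/-- A diagonal operator whose entries tend to zero is compact. -/
theorem HilbertBasis.isCompactOperator_of_diagonal [CompleteSpace H₁] (b : HilbertBasis κ ℂ H₁)
    {σ : κ → ℂ}
    (hσ : Filter.Tendsto σ Filter.cofinite (nhds 0)) {S : H₁ →L[ℂ] H₁}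
    (hS : ∀ v k, b.repr (S v) k = σ k * b.repr v k) : IsCompactOperator S := by
  classical
  let F : Finset κ → H₁ →L[ℂ] H₁ := fun s =>
    ∑ i ∈ s, (innerSL ℂ (b i)).smulRight (σ i • b i)
  have hF : ∀ s v k, b.repr (F s v) k = if k ∈ s then σ k * b.repr v k else 0 := by
    intro s v k
    simp only [F, b.repr_apply_apply, sum_apply, inner_sum,
      ContinuousLinearMap.smulRight_apply, inner_smul_right, innerSL_apply_apply,
      orthonormal_iff_ite.mp b.orthonormal]
    simp [mul_comm]
  refine isCompactOperator_of_tendsto (l := Filter.atTop) (F := F) ?_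
    (Filter.Eventually.of_forall fun s => ?_)
  · rw [Metric.tendsto_atTop]
    intro ε hε
    have hfin : {k | ¬ ‖σ k‖ < ε / 2}.Finite := by
      have h0 : ‖(0 : ℂ)‖ < ε / 2 := by simpa using hε
      exact Filter.eventually_cofinite.mp (hσ.norm.eventually_lt_const h0)
    refine ⟨hfin.toFinset, fun s hs => ?_⟩
    rw [dist_eq_norm]
    refine lt_of_le_of_lt (ContinuousLinearMap.opNorm_le_bound _ (half_pos hε).le fun v => ?_)
      (half_lt_self hε)
    refine (pow_le_pow_iff_left₀ (norm_nonneg _) (by positivity) two_ne_zero).mp ?_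
    rw [mul_pow]
    refine hasSum_le (fun k => ?_) (b.hasSum_norm_repr_sq _)
      ((b.hasSum_norm_repr_sq v).mul_left ((ε / 2) ^ 2))
    rw [sub_apply, map_sub, lp.coeFn_sub, Pi.sub_apply, hF, hS, ← mul_pow]
    refine pow_le_pow_left₀ (norm_nonneg _) ?_ 2
    split_ifs with h
    · rw [sub_self, norm_zero]; positivity
    · rw [zero_sub, norm_neg, norm_mul]
      have : ‖σ k‖ < ε / 2 := by
        by_contra h'
        exact h (hs (hfin.mem_toFinset.mpr h'))
      gcongr
  · have : F s ∈ compactOperator (RingHom.id ℂ) H₁ H₁ := by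
      refine Submodule.sum_mem _ fun i _ => ?_
      exact (isCompactOperator_of_locallyCompactSpace_rng
        (ContinuousLinearMap.toSpanSingleton ℂ (σ i • b i))).comp_clm (innerSL ℂ (b i))
    exact this

end HilbertBasis

/-! ### Sums of localized operators -/

section Localized

variable {H ι κ J : Type*} [NormedAddCommGroup H] [InnerProductSpace ℂ H] [CompleteSpace H]
  [Fintype J]
  {H' : J → Type*} [∀ j, NormedAddCommGroup (H' j)] [∀ j, InnerProductSpace ℂ (H' j)]
  [∀ j, CompleteSpace (H' j)]

/-- A compact perturbation of an invertible operator is invertible as soon as it is injective. -/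
lemma ContinuousLinearMap.isUnit_add_of_isCompactOperator {M R : H →L[ℂ] H} (hM : IsUnit M)
    (hR : IsCompactOperator R) (hinj : ∀ u, (M + R) u = 0 → u = 0) : IsUnit (M + R) := by
  obtain ⟨M, rfl⟩ := hM
  set T : H →L[ℂ] H := -((↑M⁻¹ : H →L[ℂ] H) * R) with hT
  have hMT : (M : H →L[ℂ] H) * (1 - T) = M + R := by
    rw [hT, sub_neg_eq_add, mul_add, mul_one, Units.mul_inv_cancel_left]
  have hTc : IsCompactOperator T := (hR.clm_comp (↑M⁻¹ : H →L[ℂ] H)).neg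
  rcases hTc.hasEigenvalue_or_mem_resolventSet one_ne_zero with h | h
  · obtain ⟨v, hv⟩ := h.exists_hasEigenvector
    refine absurd (hinj v ?_) hv.2
    have h1 : T v = v := by simpa using hv.apply_eq_smul
    have h2 : (1 - T) v = 0 := by rw [sub_apply, h1]; exact sub_self v
    rw [← hMT]
    change (M : H →L[ℂ] H) ((1 - T) v) = 0
    rw [h2, map_zero]
  · rw [← hMT]
    refine M.isUnit.mul ?_
    simpa [spectrum.mem_resolventSet_iff] using h

/-- The quadratic form of `∑ⱼ αⱼ Wⱼ* Wⱼ` is bounded below, so the operator is invertible. -/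
lemma isUnit_sum_smul_adjoint_comp {W : ∀ j, H →L[ℂ] H' j}
    (hW : ∀ u, ∑ j, ‖W j u‖ ^ 2 = ‖u‖ ^ 2) {α : J → ℝ} (hα : ∀ j, 0 < α j) :
    IsUnit (∑ j, (α j : ℂ) • (W j).adjoint ∘L W j) := by
  -- a positive lower bound for the `αⱼ` that makes sense for an empty index set as well
  have hc0 : 0 < (∑ j, (α j)⁻¹ + 1)⁻¹ :=
    inv_pos.mpr (add_pos_of_nonneg_of_pos (Finset.sum_nonneg fun j _ => (inv_pos.mpr (hα j)).le)
      one_pos)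
  have hc : ∀ j, (∑ j, (α j)⁻¹ + 1)⁻¹ ≤ α j := fun j => by
    refine inv_le_of_inv_le₀ (hα j) ?_
    have := Finset.single_le_sum (fun j _ => (inv_pos.mpr (hα j)).le) (Finset.mem_univ j)
    linarith
  set c := (∑ j, (α j)⁻¹ + 1)⁻¹
  refine ContinuousLinearMap.isUnit_of_forall_le_norm_inner_map _ (c := ⟨c, hc0.le⟩) hc0 fun x => ?_
  have h1 : inner ℂ ((∑ j, (α j : ℂ) • (W j).adjoint ∘L W j) x) x =
      ((∑ j, α j * ‖W j x‖ ^ 2 : ℝ) : ℂ) := by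
    rw [sum_apply, sum_inner]
    push_cast
    refine Finset.sum_congr rfl fun j _ => ?_
    change inner ℂ ((α j : ℂ) • (W j).adjoint (W j x)) x = _
    rw [inner_smul_left, ContinuousLinearMap.adjoint_inner_left, inner_self_eq_norm_sq_to_K]
    simp
  rw [h1, Complex.norm_real, Real.norm_of_nonneg
    (Finset.sum_nonneg fun j _ => mul_nonneg (hα j).le (by positivity)), ← hW, Finset.sum_mul]
  refine Finset.sum_le_sum fun j _ => ?_
  rw [mul_comm]
  exact mul_le_mul_of_nonneg_right (hc j) (by positivity)

/-- A sum `∑ⱼ Wⱼ* Sⱼ Wⱼ` in which the `Wⱼ` form a partition of unity and the `Sⱼ` are diagonal with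
positive entries is injective. -/
lemma eq_zero_of_sum_adjoint_diagonal_eq_zero {b : ∀ j, HilbertBasis κ ℂ (H' j)}
    {W : ∀ j, H →L[ℂ] H' j} (hW : ∀ u, ∑ j, ‖W j u‖ ^ 2 = ‖u‖ ^ 2)
    {σ : J → κ → ℝ} (hσ : ∀ j k, 0 < σ j k) {S : ∀ j, H' j →L[ℂ] H' j}
    (hS : ∀ j v k, (b j).repr (S j v) k = (σ j k : ℂ) * (b j).repr v k) {u : H}
    (hu : ∑ j, (W j).adjoint (S j (W j u)) = 0) : u = 0 := by
  have hpos : ∀ j, HasSum (fun k => σ j k * ‖(b j).repr (W j u) k‖ ^ 2)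
      (inner ℂ (W j u) (S j (W j u))).re := fun j => by
    have := Complex.hasSum_re ((b j).hasSum_inner_mul_inner (W j u) (S j (W j u)))
    refine this.congr_fun fun k => ?_
    rw [← (b j).repr_apply_apply, hS, ← inner_conj_symm, ← (b j).repr_apply_apply,
      mul_left_comm, RCLike.conj_mul]
    norm_cast
    rw [Complex.re_ofReal_mul]
    congr 1
  have hnn : ∀ j, 0 ≤ (inner ℂ (W j u) (S j (W j u))).re := fun j =>
    (hpos j).nonneg fun k => mul_nonneg (hσ j k).le (by positivity)
  have hsum : ∑ j, (inner ℂ (W j u) (S j (W j u))).re = 0 := by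
    rw [← Complex.re_sum]
    simp_rw [← ContinuousLinearMap.adjoint_inner_right (W _)]
    rw [← inner_sum, hu, inner_zero_right, Complex.zero_re]
  have hz : ∀ j, W j u = 0 := fun j => by
    have h0 := (Finset.sum_eq_zero_iff_of_nonneg fun j _ => hnn j).mp hsum j (Finset.mem_univ j)
    have h1 := hpos j
    rw [h0] at h1
    have h2 := (hasSum_zero_iff_of_nonneg
      fun k => mul_nonneg (hσ j k).le (sq_nonneg ‖(b j).repr (W j u) k‖)).mp h1
    rw [← (b j).repr.map_eq_zero_iff]
    ext k
    have h3 := congrFun h2 k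
    simpa [(hσ j k).ne'] using h3
  have := hW u
  simpa [hz] using this.symm

/-- Let the `Wⱼ` form a partition of unity and let `Sⱼ` be diagonal with entries `1 / λⱼ`.  If the
matrix of `Wⱼ*` almost intertwines `λⱼ` with a symbol `μⱼ` of the size of `w`, then
`∑ⱼ Wⱼ* Sⱼ Wⱼ`, followed by the multiplier `w`, is an isomorphism: up to a compact operator
it is `∑ⱼ αⱼ Wⱼ* Wⱼ`, where `αⱼ` is the limit of `w / μⱼ`. -/
theorem exists_equiv_repr_eq_mul_repr (f : HilbertBasis ι ℂ H) (b : ∀ j, HilbertBasis κ ℂ (H' j))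
    {W : ∀ j, H →L[ℂ] H' j} (hW : ∀ u, ∑ j, ‖W j u‖ ^ 2 = ‖u‖ ^ 2)
    {lam : J → κ → ℝ} (hlam : ∀ j k, 0 < lam j k)
    (hlam_top : ∀ j, Filter.Tendsto (lam j) Filter.cofinite Filter.atTop)
    {mu : J → ι → ℝ} (hmu : ∀ j m, 0 < mu j m) {w : ι → ℝ} (hw : ∀ m, 0 < w m)
    {α : J → ℝ} (hα : ∀ j, 0 < α j)
    (hlim : ∀ j, Filter.Tendsto (fun m => w m / mu j m) Filter.cofinite (nhds (α j)))
    {S : ∀ j, H' j →L[ℂ] H' j}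
    (hS : ∀ j v k, (b j).repr (S j v) k = ((lam j k)⁻¹ : ℝ) * (b j).repr v k)
    (hZ : ∀ j, ∃ Z : H' j →L[ℂ] H, ∀ v m, HasSum
      (fun k => (mu j m - lam j k : ℝ) * inner ℂ (W j (f m)) (b j k) * (b j).repr v k)
      (f.repr (Z v) m)) :
    ∃ G : H ≃L[ℂ] H, ∀ u m,
      f.repr (G u) m = w m * f.repr (∑ j, (W j).adjoint (S j (W j u))) m := by
  choose Z hZ using hZ
  have hρ : ∀ j, Filter.Tendsto (fun m => ((w m / mu j m - α j : ℝ) : ℂ)) Filter.cofinite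
      (nhds 0) := fun j => by
    rw [← Complex.ofReal_zero]
    refine (Complex.continuous_ofReal.tendsto 0).comp ?_
    simpa using (hlim j).sub_const (α j)
  have hR : ∀ j, ∃ R : H →L[ℂ] H, ∀ v m,
      f.repr (R v) m = ((w m / mu j m - α j : ℝ) : ℂ) * f.repr v m := fun j => by
    obtain ⟨C, hC⟩ := (hρ j).norm.bddAbove_range_of_cofinite
    exact f.exists_diagonal _ (C := C) fun m => hC ⟨m, rfl⟩
  choose R hR using hR
  have hRc : ∀ j, IsCompactOperator (R j) := fun j =>
    f.isCompactOperator_of_diagonal (hρ j) (hR j)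
  have hSc : ∀ j, IsCompactOperator (S j) := fun j => by
    refine (b j).isCompactOperator_of_diagonal (σ := fun k => ((lam j k)⁻¹ : ℝ)) ?_ (hS j)
    rw [← Complex.ofReal_zero]
    exact (Complex.continuous_ofReal.tendsto 0).comp (tendsto_inv_atTop_zero.comp (hlam_top j))
  have hadj : ∀ j v m, HasSum (fun k => inner ℂ (W j (f m)) (b j k) * (b j).repr v k)
      (f.repr ((W j).adjoint v) m) := fun j v m => by
    rw [f.repr_apply_apply, ContinuousLinearMap.adjoint_inner_right]
    simpa only [HilbertBasis.repr_apply_apply] using (b j).hasSum_inner_mul_inner (W j (f m)) v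
  -- `μ Wⱼ* Sⱼ = Wⱼ* + Zⱼ Sⱼ`, entry by entry: `μ E λ⁻¹ = E + (μ - λ) E λ⁻¹`
  have hcomm : ∀ j v m, (mu j m : ℂ) * f.repr ((W j).adjoint (S j v)) m =
      f.repr ((W j).adjoint v + Z j (S j v)) m := fun j v m => by
    rw [map_add, lp.coeFn_add, Pi.add_apply]
    refine ((hadj j (S j v) m).mul_left (mu j m : ℂ)).unique
      (((hadj j v m).add (hZ j (S j v) m)).congr_fun fun k => ?_)
    have := hlam j k
    have h0 : (lam j k : ℂ) ≠ 0 := by exact_mod_cast this.ne'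
    rw [hS]
    push_cast
    field_simp
    ring
  set M : H →L[ℂ] H := ∑ j, (α j : ℂ) • (W j).adjoint ∘L W j with hM
  set Q : H →L[ℂ] H := ∑ j, ((α j : ℂ) • (Z j ∘L S j ∘L W j) +
    R j ∘L ((W j).adjoint ∘L W j + Z j ∘L S j ∘L W j)) with hQ
  have hQc : IsCompactOperator Q := by
    refine Submodule.sum_mem (compactOperator (RingHom.id ℂ) H H) fun j _ => ?_
    refine IsCompactOperator.add ?_ ((hRc j).comp_clm _)
    exact (((hSc j).comp_clm (W j)).clm_comp (Z j)).smul (α j : ℂ)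
  have hrepr : ∀ u m, f.repr ((M + Q) u) m =
      w m * f.repr (∑ j, (W j).adjoint (S j (W j u))) m := fun u m => by
    rw [hM, hQ, ← Finset.sum_add_distrib, sum_apply, map_sum, map_sum]
    simp only [lp.coeFn_sum, Finset.sum_apply]
    rw [Finset.mul_sum]
    refine Finset.sum_congr rfl fun j _ => ?_
    have h0 : (mu j m : ℂ) ≠ 0 := by exact_mod_cast (hmu j m).ne'
    have h1 : f.repr ((W j).adjoint (S j (W j u))) m =
        (mu j m : ℂ)⁻¹ * f.repr ((W j).adjoint (W j u) + Z j (S j (W j u))) m := by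
      rw [← hcomm, inv_mul_cancel_left₀ h0]
    rw [h1]
    simp only [add_apply, smul_apply,
      ContinuousLinearMap.comp_apply, map_add, map_smul, lp.coeFn_add, Pi.add_apply, hR,
      lp.coeFn_smul, Pi.smul_apply, smul_eq_mul]
    push_cast
    field_simp
    ring
  have hunit : IsUnit (M + Q) := by
    refine ContinuousLinearMap.isUnit_add_of_isCompactOperator
      (isUnit_sum_smul_adjoint_comp hW hα) hQc fun u hu => ?_
    refine eq_zero_of_sum_adjoint_diagonal_eq_zero hW (fun j k => inv_pos.mpr (hlam j k)) hS ?_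
    rw [← f.repr.map_eq_zero_iff]
    ext m
    have h1 := hrepr u m
    have h0 : (w m : ℂ) ≠ 0 := by exact_mod_cast (hw m).ne'
    rw [hu, map_zero, lp.coeFn_zero, Pi.zero_apply, eq_comm, mul_eq_zero] at h1
    simpa [h0] using h1
  exact ⟨ContinuousLinearEquiv.unitsEquiv ℂ H hunit.unit, hrepr⟩

end Localized

/-! ### Summability over shifted lattices -/

lemma summable_inv_one_add_int_sq : Summable fun d : ℤ => (1 + (d : ℝ) ^ 2)⁻¹ := by
  have h : Summable fun d : ℤ => 1 / (d : ℝ) ^ 2 := Real.summable_one_div_int_pow.mpr one_lt_two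
  refine Summable.of_norm_bounded_eventually h ?_
  filter_upwards [(Set.finite_singleton (0 : ℤ)).compl_mem_cofinite] with d hd
  have hd0 : (d : ℝ) ≠ 0 := by exact_mod_cast hd
  rw [Real.norm_of_nonneg (by positivity), one_div]
  gcongr
  linarith

/-- Uniformly in the shift `t` and in the spacing `c ≥ 1`, the sums of `1 / (1 + x²)` over
`t + cℤ` are bounded. -/
lemma sum_inv_one_add_sub_mul_sq_le {c : ℝ} (hc : 1 ≤ c) (t : ℝ) (s : Finset ℤ) :
    ∑ k ∈ s, (1 + (t - c * k) ^ 2)⁻¹ ≤ 4 * ∑' d : ℤ, (1 + (d : ℝ) ^ 2)⁻¹ := by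
  -- compare `t - c k` with `k₀ - k`, where `c k₀` is the point of `cℤ` nearest to `t`
  set k₀ : ℤ := round (t / c)
  have hc0 : 0 < c := by linarith
  have h1 : ∀ k : ℤ, (1 + (t - c * k) ^ 2)⁻¹ ≤ 4 * (1 + ((k₀ - k : ℤ) : ℝ) ^ 2)⁻¹ := by
    intro k
    have h4 : 4 * (1 + ((k₀ - k : ℤ) : ℝ) ^ 2)⁻¹ = ((1 + ((k₀ - k : ℤ) : ℝ) ^ 2) / 4)⁻¹ := by
      rw [inv_div, div_eq_mul_inv]
    rw [h4]
    refine inv_anti₀ (by positivity) ?_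
    have hr : |t / c - k₀| ≤ 1 / 2 := abs_sub_round _
    have h5 : (t - c * k) ^ 2 = c ^ 2 * (t / c - k) ^ 2 := by field_simp
    have h6 : (t / c - k) ^ 2 ≤ (t - c * k) ^ 2 := by
      rw [h5]
      exact le_mul_of_one_le_left (sq_nonneg _) (one_le_pow₀ hc)
    have h7 : (((k₀ - k : ℤ) : ℝ)) ^ 2 ≤ 4 * (t / c - k) ^ 2 := by
      rcases eq_or_ne k₀ k with h | h
      · simp [h]; positivity
      · have h8 : (1 : ℝ) ≤ |((k₀ - k : ℤ) : ℝ)| := by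
          exact_mod_cast Int.one_le_abs (sub_ne_zero.mpr h)
        have h9 : |((k₀ - k : ℤ) : ℝ)| ≤ 2 * |t / c - k| := by
          have : ((k₀ - k : ℤ) : ℝ) = (t / c - k) - (t / c - k₀) := by push_cast; ring
          have h10 := abs_sub (t / c - k) (t / c - k₀)
          rw [← this] at h10
          linarith
        rw [← sq_abs ((k₀ - k : ℤ) : ℝ), ← sq_abs (t / c - k)]
        nlinarith [abs_nonneg ((k₀ - k : ℤ) : ℝ)]
    nlinarith
  calc ∑ k ∈ s, (1 + (t - c * k) ^ 2)⁻¹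
      ≤ ∑ k ∈ s, 4 * (1 + ((k₀ - k : ℤ) : ℝ) ^ 2)⁻¹ := Finset.sum_le_sum fun k _ => h1 k
    _ = 4 * ∑ d ∈ s.map (Equiv.subLeft k₀).toEmbedding, (1 + (d : ℝ) ^ 2)⁻¹ := by
        rw [Finset.sum_map, Finset.mul_sum]; rfl
    _ ≤ _ := by
        gcongr
        exact summable_inv_one_add_int_sq.sum_le_tsum _ fun d _ => by positivity

/-- Uniformly in `t ∈ ℝⁿ` and `c ≥ 1`, the sums of `∏ᵢ 1 / (1 + xᵢ²)` over `t + cℤⁿ`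
are bounded. -/
lemma summable_prod_inv_one_add_sub_mul_sq {n : ℕ} {c : ℝ} (hc : 1 ≤ c) (t : Fin n → ℝ) :
    (Summable fun k : Fin n → ℤ => ∏ i, (1 + (t i - c * k i) ^ 2)⁻¹) ∧
      ∑' k : Fin n → ℤ, ∏ i, (1 + (t i - c * k i) ^ 2)⁻¹ ≤
        (4 * ∑' d : ℤ, (1 + (d : ℝ) ^ 2)⁻¹) ^ n := by
  classical
  have h0 : ∀ k : Fin n → ℤ, 0 ≤ ∏ i, (1 + (t i - c * k i) ^ 2)⁻¹ := fun k =>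
    Finset.prod_nonneg fun i _ => by positivity
  have h1 : ∀ s : Finset (Fin n → ℤ), ∑ k ∈ s, ∏ i, (1 + (t i - c * k i) ^ 2)⁻¹ ≤
      (4 * ∑' d : ℤ, (1 + (d : ℝ) ^ 2)⁻¹) ^ n := by
    intro s
    calc ∑ k ∈ s, ∏ i, (1 + (t i - c * k i) ^ 2)⁻¹
        ≤ ∑ k ∈ Fintype.piFinset fun i => s.image fun k => k i,
            ∏ i, (1 + (t i - c * k i) ^ 2)⁻¹ := by
          refine Finset.sum_le_sum_of_subset_of_nonneg (fun k hk => ?_) fun k _ _ => h0 k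
          exact Fintype.mem_piFinset.mpr fun i => Finset.mem_image_of_mem _ hk
      _ = ∏ i, ∑ k ∈ s.image fun k => k i, (1 + (t i - c * k) ^ 2)⁻¹ :=
          (Finset.prod_univ_sum (fun i => s.image fun k => k i)
            fun i (k : ℤ) => (1 + (t i - c * k) ^ 2)⁻¹).symm
      _ ≤ ∏ _i : Fin n, (4 * ∑' d : ℤ, (1 + (d : ℝ) ^ 2)⁻¹) :=
          Finset.prod_le_prod (fun i _ => Finset.sum_nonneg fun k _ => by positivity)
            fun i _ => sum_inv_one_add_sub_mul_sq_le hc (t i) _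
      _ = _ := by rw [Finset.prod_const, Finset.card_univ, Fintype.card_fin]
  exact ⟨summable_of_sum_le h0 h1, Real.tsum_le_of_sum_le h0 h1⟩

/-! ### Cubes in `ℝⁿ`, the torus and the unit torus -/

namespace WindowedFourier

variable {n : ℕ}

/-- The open cube in `ℝⁿ` with centre `c` and side `L`. -/
def cube (c : Fin n → ℝ) (L : ℝ) : Set (Fin n → ℝ) :=
  Set.univ.pi fun i => Set.Ioo (c i - L / 2) (c i + L / 2)

/-- The quotient map `ℝⁿ → 𝕋ⁿ`. -/
noncomputable def proj (y : Fin n → ℝ) : Torus n := fun i => (y i : AddCircle (2 * π))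

lemma continuous_proj : Continuous (proj : (Fin n → ℝ) → Torus n) :=
  continuous_pi fun i => (AddCircle.continuous_mk' _).comp (continuous_apply i)

lemma measurableSet_cube (c : Fin n → ℝ) (L : ℝ) : MeasurableSet (cube c L) :=
  MeasurableSet.univ_pi fun _ => measurableSet_Ioo

lemma isOpen_cube (c : Fin n → ℝ) (L : ℝ) : IsOpen (cube c L) :=
  isOpen_set_pi Set.finite_univ fun _ _ => isOpen_Ioo

lemma mem_cube_iff {c y : Fin n → ℝ} {L : ℝ} : y ∈ cube c L ↔ ∀ i, |y i - c i| < L / 2 := by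
  simp only [cube, Set.mem_univ_pi, Set.mem_Ioo, abs_sub_lt_iff]
  exact forall_congr' fun i => ⟨fun h => ⟨by linarith [h.2], by linarith [h.1]⟩,
    fun h => ⟨by linarith [h.2], by linarith [h.1]⟩⟩

lemma norm_coe_addCircle_of_abs_le {t : ℝ} (ht : |t| ≤ π) : ‖(t : AddCircle (2 * π))‖ = |t| := by
  rw [AddCircle.norm_coe_eq_abs_iff _ Real.two_pi_pos.ne', abs_of_pos Real.two_pi_pos]
  linarith

lemma measurePreserving_proj_Ioc (c : Fin n → ℝ) :
    MeasurePreserving (proj : (Fin n → ℝ) → Torus n)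
      (volume.restrict (Set.univ.pi fun i => Set.Ioc (c i - π) (c i - π + 2 * π))) volume := by
  have := measurePreserving_pi _ _
    (fun i : Fin n => AddCircle.measurePreserving_mk (2 * π) (c i - π))
  rwa [← Measure.restrict_pi_pi] at this

lemma restrict_Ioc_eq_restrict_cube (c : Fin n → ℝ) (L : ℝ) :
    volume.restrict (Set.univ.pi fun i => Set.Ioc (c i - L / 2) (c i + L / 2)) =
      volume.restrict (cube c L) :=
  Measure.restrict_congr_set
    (Measure.univ_pi_Ioc_ae_eq_Icc.trans Measure.univ_pi_Ioo_ae_eq_Icc.symm)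

/-- The cube of side `2π` is a fundamental domain of the torus. -/
lemma measurePreserving_proj (c : Fin n → ℝ) :
    MeasurePreserving (proj : (Fin n → ℝ) → Torus n)
      (volume.restrict (cube c (2 * π))) volume := by
  have h1 : ∀ i, c i - π = c i - 2 * π / 2 := fun i => by ring
  have h2 : ∀ i, c i - π + 2 * π = c i + 2 * π / 2 := fun i => by ring
  have h := measurePreserving_proj_Ioc c
  simp only [h2] at h
  simp only [h1] at h
  rwa [restrict_Ioc_eq_restrict_cube] at h

/-- The quotient map `ℝⁿ → 𝕋ⁿ` preserves the measure on cubes of side at most `2π`. -/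
lemma measurePreserving_proj_cube (c : Fin n → ℝ) {L : ℝ} (hL : L ≤ 2 * π) :
    MeasurePreserving proj (volume.restrict (cube c L))
      ((volume : Measure (Torus n)).restrict
        {x | ∀ i, ‖x i - (c i : AddCircle (2 * π))‖ < L / 2}) := by
  have h1 := measurePreserving_proj_Ioc c
  have hm : MeasurableSet {x : Torus n | ∀ i, ‖x i - (c i : AddCircle (2 * π))‖ < L / 2} := by
    simp only [Set.ofPred_forall]
    exact MeasurableSet.iInter fun i => (isOpen_lt (by fun_prop) continuous_const).measurableSet
  have h2 := h1.restrict_preimage hm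
  rw [Measure.restrict_restrict (hm.preimage h1.measurable)] at h2
  convert h2 using 2
  ext y
  simp only [mem_cube_iff, Set.mem_inter_iff, Set.mem_preimage, Set.mem_ofPred_eq, Set.mem_univ_pi,
    Set.mem_Ioc, proj, ← AddCircle.coe_sub]
  constructor
  · intro h
    refine ⟨fun i => ?_, fun i => ?_⟩
    · rw [norm_coe_addCircle_of_abs_le (by linarith [h i])]
      exact h i
    · have := abs_lt.mp (h i)
      constructor <;> linarith
  · rintro ⟨h, h'⟩ i
    have := h i
    rwa [norm_coe_addCircle_of_abs_le
      (abs_le.mpr ⟨by linarith [(h' i).1], by linarith [(h' i).2]⟩)] at this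

/-- The Haar probability measure on `(ℝ / ℤ)ⁿ`. -/
noncomputable abbrev unitHaar (n : ℕ) : Measure (UnitAddTorus (Fin n)) :=
  Measure.pi fun _ => AddCircle.haarAddCircle

/-- The map from `(ℝ / ℤ)ⁿ` to the cube of centre `c` and side `L` that inverts `y ↦ y / L`. -/
noncomputable def toCube (c : Fin n → ℝ) (L : ℝ) (y : UnitAddTorus (Fin n)) : Fin n → ℝ :=
  fun i => L * (AddCircle.equivIoc 1 (c i / L - 1 / 2) (y i) : ℝ)

lemma measurePreserving_toCube (c : Fin n → ℝ) {L : ℝ} (hL : 0 < L) :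
    MeasurePreserving (toCube c L) (ENNReal.ofReal (L ^ n) • unitHaar n)
      (volume.restrict (cube c L)) := by
  set b : Fin n → ℝ := fun i => c i / L - 1 / 2
  have h1 : MeasurePreserving
      (fun y : UnitAddTorus (Fin n) => fun i => (AddCircle.equivIoc 1 (b i) (y i) : ℝ))
      (unitHaar n) (volume.restrict {x : Fin n → ℝ | ∀ i, x i ∈ Set.Ioc (b i) (b i + 1)}) := by
    have hm : MeasurableSet {x : Fin n → ℝ | ∀ i, x i ∈ Set.Ioc (b i) (b i + 1)} :=
      MeasurableSet.univ_pi' fun i => measurableSet_Ioc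
    have h := UnitAddTorus.measurePreserving_equivPiIoc b
    have h' : MeasurePreserving (Subtype.val :
        {x : Fin n → ℝ // ∀ i, x i ∈ Set.Ioc (b i) (b i + 1)} → Fin n → ℝ)
        (Measure.comap Subtype.val volume) (volume.restrict _) :=
      ⟨measurable_subtype_coe, map_comap_subtype_coe hm volume⟩
    exact h'.comp h
  have h2 : MeasurePreserving (fun y : Fin n → ℝ => L • y)
      (ENNReal.ofReal (L ^ n) • volume) volume := by
    refine ⟨measurable_const_smul L, ?_⟩
    rw [Measure.map_smul, Measure.map_addHaar_smul _ hL.ne', smul_smul,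
      ← ENNReal.ofReal_mul (by positivity), Module.finrank_fin_fun, abs_of_pos (by positivity),
      mul_inv_cancel₀ (by positivity), ENNReal.ofReal_one, one_smul]
  have hm : MeasurableSet (Set.univ.pi fun i => Set.Ioc (c i - L / 2) (c i + L / 2)) :=
    MeasurableSet.univ_pi fun i => measurableSet_Ioc
  have h3 := h2.restrict_preimage hm
  have h4 : (fun y : Fin n → ℝ => L • y) ⁻¹'
      (Set.univ.pi fun i => Set.Ioc (c i - L / 2) (c i + L / 2)) =
      {x : Fin n → ℝ | ∀ i, x i ∈ Set.Ioc (b i) (b i + 1)} := by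
    ext y
    simp only [Set.mem_preimage, Set.mem_univ_pi, Set.mem_Ioc, Set.mem_ofPred_eq, Pi.smul_apply,
      smul_eq_mul, b]
    refine forall_congr' fun i => ?_
    have h5 : c i / L - 1 / 2 = (c i - L / 2) / L := by field_simp
    have h6 : (c i - L / 2) / L + 1 = (c i + L / 2) / L := by field_simp; ring
    rw [h5, h6, div_lt_iff₀ hL, le_div_iff₀ hL, mul_comm L]
  rw [h4, Measure.restrict_smul] at h3
  rw [restrict_Ioc_eq_restrict_cube] at h3
  exact h3.comp (h1.smul_measure _)

/-! ### Fourier bases -/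

/-- If a map preserves measures up to a constant, the functions pulled back to the exponentials
on `(ℝ / ℤ)ⁿ` are, up to normalization, a Hilbert basis. -/
lemma exists_hilbertBasis_of_measurePreserving {X : Type*} [MeasurableSpace X] {μ : Measure X}
    {ψ : UnitAddTorus (Fin n) → X} {M : ℝ} (hM : 0 < M)
    (hψ : MeasurePreserving ψ (ENNReal.ofReal M • unitHaar n) μ)
    {e : (Fin n → ℤ) → Lp ℂ 2 μ}
    (he' : ∀ k, (e k : X → ℂ) ∘ ψ =ᵐ[ENNReal.ofReal M • unitHaar n] UnitAddTorus.mFourier k) :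
    ∃ b : HilbertBasis (Fin n → ℤ) ℂ (Lp ℂ 2 μ), ∀ k, b k = (((√M)⁻¹ : ℝ) : ℂ) • e k := by
  have hM0 : ENNReal.ofReal M ≠ 0 := by simpa using hM
  have he : ∀ k, (e k : X → ℂ) ∘ ψ =ᵐ[unitHaar n] UnitAddTorus.mFourier k := fun k =>
    (Measure.absolutelyContinuous_smul hM0).ae_eq (he' k)
  have hinner : ∀ u v : Lp ℂ 2 μ,
      inner ℂ u v = (M : ℂ) * ∫ y, inner ℂ (u (ψ y)) (v (ψ y)) ∂unitHaar n := by
    intro u v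
    have hmeas : AEStronglyMeasurable (fun x => inner ℂ (u x) (v x))
        (Measure.map ψ (ENNReal.ofReal M • unitHaar n)) := by
      rw [hψ.map_eq]
      exact (Lp.aestronglyMeasurable u).inner (Lp.aestronglyMeasurable v)
    have h1 := integral_map hψ.aemeasurable hmeas
    rwa [integral_smul_measure, hψ.map_eq, ← L2.inner_def, ENNReal.toReal_ofReal hM.le,
      Complex.real_smul] at h1
  have hbase : ∀ k l, ∫ y, inner ℂ (UnitAddTorus.mFourier k y) (UnitAddTorus.mFourier l y)
      ∂unitHaar n = if k = l then 1 else 0 := by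
    intro k l
    have := orthonormal_iff_ite.mp (UnitAddTorus.orthonormal_mFourier (d := Fin n)) k l
    rw [← this, ContinuousMap.inner_toLp]
    rfl
  have hee : ∀ k l, inner ℂ (e k) (e l) = (M : ℂ) * if k = l then 1 else 0 := by
    intro k l
    rw [hinner, ← hbase]
    congr 1
    refine integral_congr_ae ?_
    filter_upwards [he k, he l] with y h1 h2
    rw [← h1, ← h2]; rfl
  have hMs : (((√M)⁻¹ : ℝ) : ℂ) * ((((√M)⁻¹ : ℝ) : ℂ) * M) = 1 := by
    norm_cast
    rw [← mul_assoc, ← mul_inv, Real.mul_self_sqrt hM.le, inv_mul_cancel₀ hM.ne']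
  have hon : Orthonormal ℂ fun k => (((√M)⁻¹ : ℝ) : ℂ) • e k := by
    rw [orthonormal_iff_ite]
    intro k l
    rw [inner_smul_left, inner_smul_right, hee, Complex.conj_ofReal, ← mul_assoc, ← mul_assoc,
      mul_assoc (((√M)⁻¹ : ℝ) : ℂ), hMs, one_mul]
  have hs0 : (((√M)⁻¹ : ℝ) : ℂ) ≠ 0 := by
    exact_mod_cast (inv_pos.mpr (Real.sqrt_pos.mpr hM)).ne'
  have hbot : (Submodule.span ℂ (Set.range fun k => (((√M)⁻¹ : ℝ) : ℂ) • e k))ᗮ = ⊥ := by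
    rw [Submodule.eq_bot_iff]
    intro v hv
    have hv0 : ∀ k, inner ℂ (e k) v = 0 := by
      intro k
      have := hv _ (Submodule.subset_span ⟨k, rfl⟩)
      rw [inner_smul_left, Complex.conj_ofReal] at this
      exact (mul_eq_zero.mp this).resolve_left hs0
    have hmem : MemLp ((v : X → ℂ) ∘ ψ) 2 (unitHaar n) := by
      have h1 := (Lp.memLp v).comp_measurePreserving hψ
      have h2 := h1.smul_measure (c := (ENNReal.ofReal M)⁻¹) (ENNReal.inv_ne_top.mpr hM0)
      rwa [smul_smul, ENNReal.inv_mul_cancel hM0 ENNReal.ofReal_ne_top, one_smul] at h2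
    set V := hmem.toLp _ with hV
    have hV0 : V = 0 := by
      rw [← (UnitAddTorus.mFourierBasis (d := Fin n)).repr.map_eq_zero_iff]
      ext k
      rw [UnitAddTorus.mFourierBasis_repr]
      have h1 := hv0 k
      rw [hinner, mul_eq_zero, or_iff_right (by exact_mod_cast hM.ne')] at h1
      rw [lp.coeFn_zero, Pi.zero_apply, ← h1]
      refine integral_congr_ae ?_
      filter_upwards [he k, hmem.coeFn_toLp] with y h2 h3
      have h4 : V y = v (ψ y) := h3
      have h5 : e k (ψ y) = UnitAddTorus.mFourier k y := h2
      rw [h4, h5, UnitAddTorus.mFourier_neg, RCLike.inner_apply, smul_eq_mul, mul_comm]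
    have h1 : ∀ᵐ y ∂(ENNReal.ofReal M • unitHaar n), v (ψ y) = 0 := by
      refine Measure.ae_smul_measure ?_ _
      have h2 := hmem.coeFn_toLp
      rw [← hV, hV0] at h2
      filter_upwards [h2, Lp.coeFn_zero ℂ 2 (unitHaar n)] with y h3 h4
      rw [h4] at h3
      exact h3.symm
    have h2 := (ae_map_iff (p := fun x => v x = 0) hψ.aemeasurable
      ((Lp.stronglyMeasurable v).measurable (measurableSet_singleton 0))).mpr h1
    rw [hψ.map_eq] at h2
    exact (Lp.eq_zero_iff_ae_eq_zero).mpr h2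
  exact ⟨HilbertBasis.mkOfOrthogonalEqBot hon hbot, fun k => by
    rw [HilbertBasis.coe_mkOfOrthogonalEqBot]⟩

variable {K : ℕ}

lemma torusMode_proj (m : Fin n → ℤ) (y : Fin n → ℝ) :
    torusMode m (proj y) = Complex.exp (Complex.I * ((∑ i, (m i : ℝ) * y i : ℝ) : ℂ)) := by
  change ∏ i, fourier (m i) ((y i : ℝ) : AddCircle (2 * π)) = _
  push_cast
  rw [Finset.mul_sum, Complex.exp_sum]
  refine Finset.prod_congr rfl fun i _ => ?_
  rw [fourier_coe_apply]
  congr 1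
  have : (π : ℂ) ≠ 0 := by exact_mod_cast Real.pi_ne_zero
  push_cast
  field_simp

lemma toCube_mFourier (c : Fin n → ℝ) {L : ℝ} (hL : 0 < L) (k : Fin n → ℤ)
    (y : UnitAddTorus (Fin n)) :
    Complex.exp (Complex.I * ((∑ i, (2 * π / L * k i) * toCube c L y i : ℝ) : ℂ)) =
      UnitAddTorus.mFourier k y := by
  change _ = ∏ i, fourier (k i) (y i)
  push_cast
  rw [Finset.mul_sum, Complex.exp_sum]
  refine Finset.prod_congr rfl fun i _ => ?_
  set t := AddCircle.equivIoc 1 (c i / L - 1 / 2) (y i) with ht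
  have h1 : y i = ((t : ℝ) : AddCircle (1 : ℝ)) := by
    rw [ht]
    exact ((AddCircle.equivIoc 1 (c i / L - 1 / 2)).symm_apply_apply (y i)).symm
  rw [h1, fourier_coe_apply, toCube, ← ht]
  congr 1
  have : (L : ℂ) ≠ 0 := by exact_mod_cast hL.ne'
  push_cast
  field_simp

/-- The normalized exponentials on the torus form a Hilbert basis. -/
lemma exists_torusBasis (n : ℕ) : ∃ b : HilbertBasis (Fin n → ℤ) ℂ (L2 n), ∀ m,
    b m = (((√((2 * π) ^ n))⁻¹ : ℝ) : ℂ) • ContinuousMap.toLp 2 volume ℂ (torusMode m) := by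
  have hψ := (measurePreserving_proj 0).comp
    (measurePreserving_toCube (n := n) 0 Real.two_pi_pos)
  refine exists_hilbertBasis_of_measurePreserving (by positivity) hψ fun m => ?_
  refine (hψ.quasiMeasurePreserving.ae_eq_comp
    (ContinuousMap.coeFn_toLp (p := 2) (𝕜 := ℂ) volume (torusMode m))).trans
    (ae_of_all _ fun y => ?_)
  rw [← toCube_mFourier 0 Real.two_pi_pos, Function.comp_apply, Function.comp_apply,
    torusMode_proj]
  simp

lemma four_pi_div_le (hK : 2 ≤ K) : 4 * π / K ≤ 2 * π := by
  have : (2 : ℝ) ≤ K := by exact_mod_cast hK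
  rw [div_le_iff₀ (by linarith)]
  nlinarith [Real.pi_pos]

lemma four_pi_div_pos (hK : 2 ≤ K) : 0 < 4 * π / K := by
  have : (0 : ℝ) < K := by exact_mod_cast (by omega : 0 < K)
  positivity

lemma measurePreserving_proj_block (hK : 2 ≤ K) (j : Fin n → Fin K) :
    MeasurePreserving proj (volume.restrict (cube (centerCoord j) (4 * π / K)))
      ((volume : Measure (Torus n)).restrict (block j)) := by
  have h := measurePreserving_proj_cube (centerCoord j) (four_pi_div_le hK)
  rwa [show 4 * π / K / 2 = 2 * π / K by ring] at h

lemma lift_proj (hK : 2 ≤ K) (j : Fin n → Fin K) {y : Fin n → ℝ}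
    (hy : y ∈ cube (centerCoord j) (4 * π / K)) (i : Fin n) : lift j (proj y) i = y i := by
  have h := abs_lt.mp (mem_cube_iff.mp hy i)
  have hL := four_pi_div_le hK
  rw [lift, proj, AddCircle.equivIco_coe_eq]
  constructor <;> linarith

lemma blockModeFun_proj (hK : 2 ≤ K) (j : Fin n → Fin K) (k : Fin n → ℤ) {y : Fin n → ℝ}
    (hy : y ∈ cube (centerCoord j) (4 * π / K)) :
    blockModeFun j k (proj y) = Complex.exp (Complex.I * ((∑ i, freq K k i * y i : ℝ) : ℂ)) := by
  simp only [blockModeFun, lift_proj hK j hy]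

/-- The normalized exponentials on a block form a Hilbert basis. -/
lemma exists_blockBasis (hK : 2 ≤ K) (j : Fin n → Fin K) :
    ∃ b : HilbertBasis (Fin n → ℤ) ℂ (L2Block j), ∀ k,
      b k = (((√((4 * π / K) ^ n))⁻¹ : ℝ) : ℂ) • blockMode j k := by
  have hL := four_pi_div_pos hK
  have hK0 : (K : ℝ) ≠ 0 := by exact_mod_cast (by omega : K ≠ 0)
  have hρ := measurePreserving_toCube (centerCoord j) hL
  have hψ := (measurePreserving_proj_block hK j).comp hρ
  refine exists_hilbertBasis_of_measurePreserving (by positivity) hψ fun k => ?_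
  refine (hψ.quasiMeasurePreserving.ae_eq_comp
    (MemLp.coeFn_toLp (memLp_blockModeFun j k))).trans ?_
  filter_upwards [hρ.quasiMeasurePreserving.ae
    (ae_restrict_mem (measurableSet_cube (centerCoord j) (4 * π / K)))] with y hy
  rw [← toCube_mFourier (centerCoord j) hL, Function.comp_apply, Function.comp_apply,
    blockModeFun_proj hK j k hy]
  have : ∀ i, freq K k i = 2 * π / (4 * π / K) * k i := fun i => by
    rw [freq]; field_simp; norm_num; ring
  simp only [this]

/-! ### The windowing operators -/

lemma window_eq_zero (w : WindowFamily n K) {j : Fin n → Fin K} {x : Torus n}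
    (hx : x ∉ block j) : w.g j x = 0 :=
  image_eq_zero_of_notMem_tsupport fun h => hx (w.support_subset j h)

/-- The windowing operator is an isometry because the squares of the windows sum to `1`. -/
lemma sum_norm_windowing_sq (w : WindowFamily n K) (u : L2 n) :
    ∑ j, ‖windowing w j u‖ ^ 2 = ‖u‖ ^ 2 := by
  have hu : Integrable (fun x => ‖u x‖ ^ 2) (volume : Measure (Torus n)) :=
    (memLp_two_iff_integrable_sq_norm (Lp.aestronglyMeasurable u)).mp (Lp.memLp u)
  have hsq : ∀ {μ : Measure (Torus n)} (v : Lp ℂ 2 μ), ‖v‖ ^ 2 = ∫ x, ‖v x‖ ^ 2 ∂μ := by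
    intro μ v
    have h := congrArg Complex.re (L2.inner_def (𝕜 := ℂ) v v)
    have h1 : ∀ x, inner ℂ (v x) (v x) = ((‖v x‖ ^ 2 : ℝ) : ℂ) := fun x => by
      rw [inner_self_eq_norm_sq_to_K]; simp
    simp only [h1] at h
    rw [inner_self_eq_norm_sq_to_K] at h
    norm_cast at h
  have hj : ∀ j, ‖windowing w j u‖ ^ 2 = ∫ x, w.g j x ^ 2 * ‖u x‖ ^ 2 := fun j => by
    rw [hsq, ← setIntegral_eq_integral_of_forall_compl_eq_zero (s := block j)
      (f := fun x => w.g j x ^ 2 * ‖u x‖ ^ 2) (fun x hx => by simp [window_eq_zero w hx])]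
    refine integral_congr_ae ?_
    filter_upwards [windowing_coeFn w j u] with x hx
    rw [hx, norm_mul, mul_pow, Complex.norm_real, Real.norm_eq_abs, sq_abs]
  have hint : ∀ j, Integrable (fun x => w.g j x ^ 2 * ‖u x‖ ^ 2)
      (volume : Measure (Torus n)) := fun j => by
    refine hu.mono' (by
      exact (((w.g j).continuous.pow 2).aestronglyMeasurable).mul hu.aestronglyMeasurable)
      (ae_of_all _ fun x => ?_)
    rw [Real.norm_of_nonneg (by positivity)]
    refine mul_le_of_le_one_left (by positivity) ?_
    rw [← w.sum_sq x]
    exact Finset.single_le_sum (f := fun j => w.g j x ^ 2) (fun j _ => sq_nonneg _)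
      (Finset.mem_univ j)
  simp_rw [hj]
  rw [← integral_finsetSum _ fun j _ => hint j, hsq]
  refine integral_congr_ae (ae_of_all _ fun x => ?_)
  simp only
  rw [← Finset.sum_mul, w.sum_sq, one_mul]

/-- The matrix entry of the `j`-th window between a block mode and a torus mode is, on the cube in
`ℝⁿ`, the Fourier integral of the window at the difference of the frequencies. -/
lemma inner_windowing_torusMode_blockMode (hK : 2 ≤ K) (w : WindowFamily n K) (j : Fin n → Fin K)
    (m k : Fin n → ℤ) :
    inner ℂ (windowing w j (ContinuousMap.toLp 2 volume ℂ (torusMode m))) (blockMode j k) =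
      ∫ y in cube (centerCoord j) (4 * π / K), Complex.exp
        (-Complex.I * ((∑ i, ((m i : ℝ) - freq K k i) * y i : ℝ) : ℂ)) * (w.g j (proj y) : ℂ) := by
  have hp := measurePreserving_proj_block hK j
  set T := ContinuousMap.toLp 2 (volume : Measure (Torus n)) ℂ (torusMode m) with hT
  have h1 : inner ℂ (windowing w j T) (blockMode j k) =
      ∫ x in block j, (starRingEnd ℂ) (torusMode m x) * (w.g j x : ℂ) * blockModeFun j k x := by
    rw [L2.inner_def]
    refine integral_congr_ae ?_
    filter_upwards [windowing_coeFn w j T, MemLp.coeFn_toLp (memLp_blockModeFun j k),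
      ae_restrict_of_ae (ContinuousMap.coeFn_toLp (p := 2) (𝕜 := ℂ) (volume : Measure (Torus n))
        (torusMode m))] with x hx1 hx2 hx3
    have hx2' : blockMode j k x = blockModeFun j k x := hx2
    rw [hx1, hx2', hT, hx3, RCLike.inner_apply, map_mul, Complex.conj_ofReal]
    ring
  have hmeas : AEStronglyMeasurable (fun x => (starRingEnd ℂ) (torusMode m x) * (w.g j x : ℂ) *
      blockModeFun j k x)
      (Measure.map proj (volume.restrict (cube (centerCoord j) (4 * π / K)))) := by
    rw [hp.map_eq]
    refine AEStronglyMeasurable.mul (Continuous.aestronglyMeasurable (by fun_prop))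
      (memLp_blockModeFun j k).aestronglyMeasurable
  rw [h1, ← hp.map_eq, integral_map hp.aemeasurable hmeas]
  refine setIntegral_congr_fun (measurableSet_cube _ _) fun y hy => ?_
  rw [blockModeFun_proj hK j k hy, torusMode_proj, ← Complex.exp_conj, mul_right_comm,
    ← Complex.exp_add]
  congr 2
  rw [map_mul, Complex.conj_I, Complex.conj_ofReal, neg_mul, neg_mul, neg_add_eq_sub, ← mul_sub,
    ← mul_neg]
  congr 1
  push_cast
  rw [← Finset.sum_sub_distrib, ← Finset.sum_neg_distrib]
  exact Finset.sum_congr rfl fun i _ => by ring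

/-! ### Decay of the matrix entries -/

/-- A window, transplanted to `ℝⁿ` and extended by zero outside its cube. -/
noncomputable def windowOnSpace (w : WindowFamily n K) (j : Fin n → Fin K) : (Fin n → ℝ) → ℂ :=
  (cube (centerCoord j) (4 * π / K)).indicator fun y => (w.g j (proj y) : ℂ)

/-- The part of the closed cube lying over the support of the window; it is compact and contained
in the open cube. -/
lemma exists_compact_subset_cube (hK : 2 ≤ K) (w : WindowFamily n K) (j : Fin n → Fin K) :
    ∃ Q : Set (Fin n → ℝ), IsCompact Q ∧ Q ⊆ cube (centerCoord j) (4 * π / K) ∧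
      ∀ y ∉ Q, windowOnSpace w j y = 0 := by
  refine ⟨(Set.univ.pi fun i => Set.Icc (centerCoord j i - 2 * π / K) (centerCoord j i + 2 * π / K))
    ∩ proj ⁻¹' tsupport (w.g j), ?_, ?_, ?_⟩
  · exact (isCompact_univ_pi fun _ => isCompact_Icc).inter_right
      ((isClosed_tsupport _).preimage continuous_proj)
  · rintro y ⟨h1, h2⟩
    have h3 : ∀ i, ‖((y i : ℝ) : AddCircle (2 * π)) - center j i‖ < 2 * π / K :=
      w.support_subset j h2
    refine mem_cube_iff.mpr fun i => ?_
    have h4 := h3 i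
    have hL := four_pi_div_le hK
    have hLK : 4 * π / K = 2 * (2 * π / K) := by ring
    have h5 := h1 i (Set.mem_univ i)
    rw [center, ← AddCircle.coe_sub, norm_coe_addCircle_of_abs_le
      (abs_le.mpr ⟨by linarith [h5.1], by linarith [h5.2]⟩)] at h4
    linarith
  · intro y hy
    by_cases hc : y ∈ cube (centerCoord j) (4 * π / K)
    · rw [windowOnSpace, Set.indicator_of_mem hc, Complex.ofReal_eq_zero]
      refine image_eq_zero_of_notMem_tsupport fun h => hy ⟨fun i _ => ?_, h⟩
      have h1 := abs_lt.mp (mem_cube_iff.mp hc i)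
      have hLK : 4 * π / K = 2 * (2 * π / K) := by ring
      constructor <;> linarith
    · exact Set.indicator_of_notMem hc _

lemma hasCompactSupport_windowOnSpace (hK : 2 ≤ K) (w : WindowFamily n K) (j : Fin n → Fin K) :
    HasCompactSupport (windowOnSpace w j) := by
  obtain ⟨Q, hQ, -, h0⟩ := exists_compact_subset_cube hK w j
  exact HasCompactSupport.intro hQ fun y hy => h0 y hy

lemma contDiff_windowOnSpace (hK : 2 ≤ K) (w : WindowFamily n K) (j : Fin n → Fin K) :
    ContDiff ℝ ∞ (windowOnSpace w j) := by
  obtain ⟨Q, hQ, hQc, h0⟩ := exists_compact_subset_cube hK w j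
  rw [contDiff_iff_contDiffAt]
  intro y
  by_cases hc : y ∈ cube (centerCoord j) (4 * π / K)
  · have h1 : ContDiff ℝ ∞ fun y : Fin n → ℝ => (w.g j (proj y) : ℂ) :=
      Complex.ofRealCLM.contDiff.comp (w.smooth j)
    refine h1.contDiffAt.congr_of_eventuallyEq ?_
    filter_upwards [(isOpen_cube _ _).mem_nhds hc] with z hz
    exact Set.indicator_of_mem hz _
  · refine (contDiffAt_const (c := (0 : ℂ))).congr_of_eventuallyEq ?_
    filter_upwards [hQ.isClosed.isOpen_compl.mem_nhds fun h => hc (hQc h)] with z hz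
    exact h0 z hz

/-- The Fourier transform of a window decays rapidly, because the window is smooth with compact
support. -/
lemma exists_decay_integral_window (hK : 2 ≤ K) (w : WindowFamily n K) (j : Fin n → Fin K) :
    ∃ C : ℝ, 0 < C ∧ ∀ η : Fin n → ℝ, √(∑ i, η i ^ 2) *
      ‖∫ y in cube (centerCoord j) (4 * π / K),
        Complex.exp (-Complex.I * ((∑ i, η i * y i : ℝ) : ℂ)) * (w.g j (proj y) : ℂ)‖ ≤
      C * ∏ i, (1 + η i ^ 2)⁻¹ := by
  let e : EuclideanSpace ℝ (Fin n) ≃L[ℝ] (Fin n → ℝ) := EuclideanSpace.equiv (Fin n) ℝ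
  have hcs : HasCompactSupport (windowOnSpace w j ∘ e) :=
    (hasCompactSupport_windowOnSpace hK w j).comp_homeomorph e.toHomeomorph
  have hsm : ContDiff ℝ ∞ (windowOnSpace w j ∘ e) :=
    (contDiff_windowOnSpace hK w j).comp e.contDiff
  set φ : SchwartzMap (EuclideanSpace ℝ (Fin n)) ℂ := hcs.toSchwartzMap hsm
  set N := 2 * n + 1 with hN
  obtain ⟨C, hC⟩ : ∃ C, ∀ x, (1 + ‖x‖) ^ N * ‖FourierTransform.fourier φ x‖ ≤ C :=
    ⟨_, fun x => by
      simpa using SchwartzMap.one_add_le_sup_seminorm_apply (𝕜 := ℝ) (m := (N, 0)) le_rfl le_rfl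
        (FourierTransform.fourier φ) x⟩
  have hint : ∀ η : Fin n → ℝ, ∫ y in cube (centerCoord j) (4 * π / K),
      Complex.exp (-Complex.I * ((∑ i, η i * y i : ℝ) : ℂ)) * (w.g j (proj y) : ℂ) =
      FourierTransform.fourier φ ((2 * π)⁻¹ • WithLp.toLp 2 η) := by
    intro η
    rw [SchwartzMap.fourier_coe, Real.fourier_eq', ← integral_indicator (measurableSet_cube _ _),
      ← (EuclideanSpace.volume_preserving_symm_measurableEquiv_toLp (Fin n)).integral_comp']
    refine integral_congr_ae (ae_of_all _ fun v => ?_)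
    have h1 : φ v = windowOnSpace w j (e v) := rfl
    have h2 : inner ℝ v ((2 * π)⁻¹ • WithLp.toLp 2 η) = (2 * π)⁻¹ * ∑ i, η i * e v i := by
      rw [inner_smul_right, PiLp.inner_apply]
      simp [e]
    have h3 : -2 * π * ((2 * π)⁻¹ * ∑ i, η i * e v i) = -∑ i, η i * e v i := by
      have := Real.pi_ne_zero
      field_simp
    change Set.indicator _ _ (e v) = _
    simp only [h1, h2, h3]
    rw [windowOnSpace, smul_eq_mul, Complex.ofReal_neg, neg_mul, mul_comm _ Complex.I, ← neg_mul]
    by_cases hv : e v ∈ cube (centerCoord j) (4 * π / K)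
    · rw [Set.indicator_of_mem hv, Set.indicator_of_mem hv]
    · rw [Set.indicator_of_notMem hv, Set.indicator_of_notMem hv, mul_zero]
  refine ⟨(2 * π) ^ N * (|C| + 1), by positivity, fun η => ?_⟩
  rw [hint]
  set x := (2 * π)⁻¹ • WithLp.toLp 2 η with hx
  set r := √(∑ i, η i ^ 2) with hr
  have hr0 : 0 ≤ r := Real.sqrt_nonneg _
  have hxr : 1 + r ≤ 2 * π * (1 + ‖x‖) := by
    have h1 : ‖x‖ = (2 * π)⁻¹ * r := by
      rw [hx, norm_smul, EuclideanSpace.norm_eq, Real.norm_of_nonneg (by positivity)]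
      simp [hr]
    have h2 : 2 * π * ((2 * π)⁻¹ * r) = r := by
      have := Real.pi_ne_zero
      field_simp
    rw [h1, mul_add, h2]
    linarith [Real.pi_gt_three]
  have hprod : ∏ i, (1 + η i ^ 2) ≤ ((1 + r) ^ 2) ^ n := by
    have h1 : ∀ i, 1 + η i ^ 2 ≤ (1 + r) ^ 2 := fun i => by
      have h2 : η i ^ 2 ≤ r ^ 2 := by
        rw [hr, Real.sq_sqrt (Finset.sum_nonneg fun i _ => sq_nonneg _)]
        exact Finset.single_le_sum (f := fun i => η i ^ 2) (fun i _ => sq_nonneg _)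
          (Finset.mem_univ i)
      nlinarith
    calc ∏ i, (1 + η i ^ 2) ≤ ∏ _i : Fin n, (1 + r) ^ 2 :=
          Finset.prod_le_prod (fun i _ => by positivity) fun i _ => h1 i
      _ = _ := by rw [Finset.prod_const, Finset.card_univ, Fintype.card_fin]
  have hp0 : 0 < ∏ i, (1 + η i ^ 2) := Finset.prod_pos fun i _ => by positivity
  rw [Finset.prod_inv_distrib, ← div_eq_mul_inv, le_div_iff₀ hp0]
  calc r * ‖FourierTransform.fourier φ x‖ * ∏ i, (1 + η i ^ 2)
      ≤ (1 + r) * ‖FourierTransform.fourier φ x‖ * ((1 + r) ^ 2) ^ n := by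
        gcongr
        linarith
    _ = (1 + r) ^ N * ‖FourierTransform.fourier φ x‖ := by rw [hN, pow_succ (1 + r) (2 * n), pow_mul]; ring
    _ ≤ (2 * π * (1 + ‖x‖)) ^ N * ‖FourierTransform.fourier φ x‖ := by gcongr
    _ = (2 * π) ^ N * ((1 + ‖x‖) ^ N * ‖FourierTransform.fourier φ x‖) := by
        rw [mul_pow, mul_assoc]
    _ ≤ (2 * π) ^ N * (|C| + 1) := by
        gcongr
        exact (hC x).trans ((le_abs_self C).trans (by linarith))

/-! ### The symbols -/

/-- The function `x ↦ (1 + a |x|²)^{1/2}` is Lipschitz with constant `a^{1/2}`. -/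
lemma abs_sqrt_sub_sqrt_le {a : ℝ} (ha : 0 ≤ a) (x y : Fin n → ℝ) :
    |√(1 + a * ∑ i, x i ^ 2) - √(1 + a * ∑ i, y i ^ 2)| ≤ √a * √(∑ i, (x i - y i) ^ 2) := by
  set X := ∑ i, x i ^ 2
  set Y := ∑ i, y i ^ 2
  set p := ∑ i, x i * y i
  have hX : 0 ≤ X := Finset.sum_nonneg fun i _ => sq_nonneg _
  have hY : 0 ≤ Y := Finset.sum_nonneg fun i _ => sq_nonneg _
  have hD : ∑ i, (x i - y i) ^ 2 = X + Y - 2 * p := by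
    simp only [X, Y, p, Finset.mul_sum, ← Finset.sum_add_distrib, ← Finset.sum_sub_distrib]
    exact Finset.sum_congr rfl fun i _ => by ring
  have hD0 : 0 ≤ X + Y - 2 * p := hD ▸ Finset.sum_nonneg fun i _ => sq_nonneg _
  have hcs : p ^ 2 ≤ X * Y := Finset.sum_mul_sq_le_sq_mul_sq _ _ _
  have hA : 0 ≤ 1 + a * X := by positivity
  have hB : 0 ≤ 1 + a * Y := by positivity
  have hp : 1 + a * p ≤ √(1 + a * X) * √(1 + a * Y) := by
    rw [← Real.sqrt_mul hA]
    refine Real.le_sqrt_of_sq_le ?_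
    nlinarith [mul_nonneg ha hD0, mul_le_mul_of_nonneg_left hcs (sq_nonneg a)]
  rw [← Real.sqrt_mul ha, hD]
  refine Real.le_sqrt_of_sq_le ?_
  rw [sq_abs, sub_sq, Real.sq_sqrt hA, Real.sq_sqrt hB]
  nlinarith

lemma tendsto_sum_sq_cofinite (n : ℕ) : Filter.Tendsto (fun m : Fin n → ℤ => ∑ i, (m i : ℝ) ^ 2)
    Filter.cofinite Filter.atTop := by
  rw [Filter.tendsto_atTop]
  intro R
  rw [Filter.eventually_cofinite]
  refine (Set.finite_Icc (fun _ : Fin n => -(⌈R⌉₊ : ℤ)) fun _ => (⌈R⌉₊ : ℤ)).subset fun m hm => ?_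
  have h1 : ∀ i, |m i| ≤ (⌈R⌉₊ : ℤ) := fun i => by
    have h2 : ∑ i, (m i : ℝ) ^ 2 < R := not_le.mp hm
    have h3 : (m i : ℝ) ^ 2 ≤ ∑ i, (m i : ℝ) ^ 2 :=
      Finset.single_le_sum (f := fun i => (m i : ℝ) ^ 2) (fun i _ => sq_nonneg _)
        (Finset.mem_univ i)
    have h4 : (m i : ℝ) ^ 2 ≤ (⌈R⌉₊ : ℤ) := by
      push_cast
      linarith [Nat.le_ceil R]
    have h5 : m i ^ 2 ≤ (⌈R⌉₊ : ℤ) := by exact_mod_cast h4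
    refine le_trans ?_ h5
    rw [← sq_abs]
    exact Int.le_self_sq _
  exact ⟨fun i => (abs_le.mp (h1 i)).1, fun i => (abs_le.mp (h1 i)).2⟩

/-- The quotient of the symbols `(1 + |m|²)^{1/2}` and `(1 + a |m|²)^{1/2}` tends to
`a^{-1/2}`. -/
lemma tendsto_sqrt_h1Weight_div {a : ℝ} (ha : 0 < a) :
    Filter.Tendsto (fun m : Fin n → ℤ => √(h1Weight m) / √(1 + a * ∑ i, (m i : ℝ) ^ 2))
      Filter.cofinite (nhds √(a⁻¹)) := by
  have h1 : ∀ m : Fin n → ℤ, √(h1Weight m) / √(1 + a * ∑ i, (m i : ℝ) ^ 2) =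
      √(a⁻¹ + (1 - a⁻¹) / (1 + a * ∑ i, (m i : ℝ) ^ 2)) := fun m => by
    rw [← Real.sqrt_div (h1Weight_nonneg m), h1Weight]
    congr 1
    have : 0 < 1 + a * ∑ i, (m i : ℝ) ^ 2 := by positivity
    field_simp
    ring
  simp only [h1]
  refine (Real.continuous_sqrt.tendsto _).comp ?_
  have h2 : Filter.Tendsto (fun m : Fin n → ℤ => 1 + a * ∑ i, (m i : ℝ) ^ 2) Filter.cofinite
      Filter.atTop :=
    Filter.tendsto_atTop_add_const_left _ _ ((tendsto_sum_sq_cofinite n).const_mul_atTop ha)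
  simpa using (h2.const_div_atTop (1 - a⁻¹)).const_add a⁻¹

lemma tendsto_sqrt_freq (hK : 2 ≤ K) {a : ℝ} (ha : 0 < a) :
    Filter.Tendsto (fun k : Fin n → ℤ => √(1 + a * ∑ i, freq K k i ^ 2))
      Filter.cofinite Filter.atTop := by
  have hK0 : (0 : ℝ) < K := by exact_mod_cast (by omega : 0 < K)
  refine Real.tendsto_sqrt_atTop.comp (Filter.tendsto_atTop_add_const_left _ _
    (Filter.Tendsto.const_mul_atTop ha ?_))
  simp only [freq, mul_pow, ← Finset.mul_sum]
  exact (tendsto_sum_sq_cofinite n).const_mul_atTop (by positivity)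

/-! ### The commutator of a window with the symbols -/

/-- The matrix entries of a window decay rapidly in the difference of the frequencies and the symbols
are Lipschitz, so the difference of the symbols times the matrix passes the Schur test.  Here the
rows are indexed by the frequencies `m ∈ ℤⁿ` of the torus and the columns by the frequencies
`ξ_k = (K / 2) k` of the block, two lattices that need not contain one another. -/
lemma exists_clm_symbol_sub (hK : 2 ≤ K) {a : ℝ} (ha : 0 ≤ a) (w : WindowFamily n K)
    (j : Fin n → Fin K)
    {f : HilbertBasis (Fin n → ℤ) ℂ (L2 n)} {s : ℝ}
    (hf : ∀ m, f m = (s : ℂ) • ContinuousMap.toLp 2 volume ℂ (torusMode m))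
    {b : HilbertBasis (Fin n → ℤ) ℂ (L2Block j)} {t : ℝ}
    (hb : ∀ k, b k = (t : ℂ) • blockMode j k) :
    ∃ Z : L2Block j →L[ℂ] L2 n, ∀ v m, HasSum
      (fun k => ((√(1 + a * ∑ i, (m i : ℝ) ^ 2) - √(1 + a * ∑ i, freq K k i ^ 2) : ℝ) : ℂ) *
        inner ℂ (windowing w j (f m)) (b k) * b.repr v k) (f.repr (Z v) m) := by
  obtain ⟨C, hC, hdecay⟩ := exists_decay_integral_window hK w j
  set D := √a * (|s| * |t| * C) with hD
  have hD0 : 0 ≤ D := by positivity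
  set A : (Fin n → ℤ) → (Fin n → ℤ) → ℂ := fun m k =>
    ((√(1 + a * ∑ i, (m i : ℝ) ^ 2) - √(1 + a * ∑ i, freq K k i ^ 2) : ℝ) : ℂ) *
      inner ℂ (windowing w j (f m)) (b k) with hA
  have hAle : ∀ m k, ‖A m k‖ ≤ D * ∏ i, (1 + ((m i : ℝ) - K / 2 * k i) ^ 2)⁻¹ := by
    intro m k
    have h1 := abs_sqrt_sub_sqrt_le ha (fun i => (m i : ℝ)) (freq K k)
    have h2 := hdecay fun i => (m i : ℝ) - freq K k i
    rw [← inner_windowing_torusMode_blockMode hK w j m k] at h2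
    rw [hA, norm_mul, Complex.norm_real, Real.norm_eq_abs, hf, hb, map_smul, inner_smul_left,
      inner_smul_right, norm_mul, norm_mul, Complex.conj_ofReal, Complex.norm_real,
      Complex.norm_real, Real.norm_eq_abs, Real.norm_eq_abs]
    refine (mul_le_mul_of_nonneg_right h1 (by positivity)).trans ?_
    calc _ = √a * (|s| * |t| * (√(∑ i, ((m i : ℝ) - freq K k i) ^ 2) *
            ‖inner ℂ (windowing w j (ContinuousMap.toLp 2 volume ℂ (torusMode m)))
              (blockMode j k)‖)) := by ring
      _ ≤ √a * (|s| * |t| * (C * ∏ i, (1 + ((m i : ℝ) - freq K k i) ^ 2)⁻¹)) := by gcongr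
      _ = _ := by rw [hD]; simp only [freq]; ring
  have hrow : ∀ m : Fin n → ℤ, _ := fun m =>
    summable_prod_inv_one_add_sub_mul_sq (n := n) (c := (K : ℝ) / 2)
      (by rw [le_div_iff₀ two_pos]; exact_mod_cast (by omega : 1 * 2 ≤ K)) fun i => (m i : ℝ)
  have hcol : ∀ k : Fin n → ℤ, _ := fun k =>
    summable_prod_inv_one_add_sub_mul_sq (n := n) le_rfl fun i => (K : ℝ) / 2 * (k i : ℝ)
  have hswap : ∀ m k : Fin n → ℤ, ∏ i, (1 + ((K : ℝ) / 2 * (k i : ℝ) - 1 * m i) ^ 2)⁻¹ =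
      ∏ i, (1 + ((m i : ℝ) - K / 2 * k i) ^ 2)⁻¹ := fun m k =>
    Finset.prod_congr rfl fun i _ => by congr 2; ring
  simp only [hswap] at hcol
  set B := (4 * ∑' d : ℤ, (1 + (d : ℝ) ^ 2)⁻¹) ^ n with hB
  have hr : ∀ m, Summable fun k => ‖A m k‖ := fun m =>
    Summable.of_nonneg_of_le (fun _ => norm_nonneg _) (hAle m) ((hrow m).1.mul_left D)
  have hc : ∀ k, Summable fun m => ‖A m k‖ := fun k =>
    Summable.of_nonneg_of_le (fun _ => norm_nonneg _) (fun m => hAle m k) ((hcol k).1.mul_left D)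
  refine b.exists_clm_of_schur f A (C := max (D * B) 1) (by positivity) hr (fun m => ?_) hc
    (fun k => ?_)
  · refine le_max_of_le_left (((hr m).tsum_le_tsum (hAle m) ((hrow m).1.mul_left D)).trans ?_)
    rw [tsum_mul_left]
    exact mul_le_mul_of_nonneg_left (hrow m).2 hD0
  · refine le_max_of_le_left (((hc k).tsum_le_tsum (fun m => hAle m k)
      ((hcol k).1.mul_left D)).trans ?_)
    rw [tsum_mul_left]
    exact mul_le_mul_of_nonneg_left (hcol k).2 hD0

/-! ### The operator `P` and the Sobolev norm in Hilbert bases -/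

/-- The series defining `S_j` converges to the diagonal operator with entries
`(1 + a(x_j) |ξ_k|²)^{-1/2}`. -/
lemma blockOperator_eq (hK : 2 ≤ K) (a : Torus n → ℝ) (j : Fin n → Fin K)
    {b : HilbertBasis (Fin n → ℤ) ℂ (L2Block j)}
    (hb : ∀ k, b k = (((√((4 * π / K) ^ n))⁻¹ : ℝ) : ℂ) • blockMode j k)
    {S : L2Block j →L[ℂ] L2Block j}
    (hS : ∀ v k, b.repr (S v) k =
      (((√(1 + a (center j) * ∑ i, freq K k i ^ 2))⁻¹ : ℝ) : ℂ) * b.repr v k)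
    (ha : 0 ≤ a (center j)) (v : L2Block j) : blockOperator a j v = S v := by
  have hL := four_pi_div_pos hK
  rw [blockOperator, blockFourierInv]
  refine (Eq.trans ?_ (b.hasSum_repr (S v)).tsum_eq)
  refine tsum_congr fun k => ?_
  have h1 : symbolInvSqrt a j k = (√(1 + a (center j) * ∑ i, freq K k i ^ 2))⁻¹ := by
    rw [symbolInvSqrt, Real.sqrt_eq_rpow, Real.rpow_neg]
    have := Finset.sum_nonneg fun i (_ : i ∈ Finset.univ) => sq_nonneg (freq K k i)
    positivity
  have h2 : ((((4 * π / K) ^ n : ℝ)) : ℂ)⁻¹ = (((√((4 * π / K) ^ n))⁻¹ : ℝ) : ℂ) *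
      (((√((4 * π / K) ^ n))⁻¹ : ℝ) : ℂ) := by
    rw [← Complex.ofReal_mul, ← mul_inv, Real.mul_self_sqrt (by positivity), Complex.ofReal_inv]
  rw [hS, b.repr_apply_apply, hb, inner_smul_left, Complex.conj_ofReal, smul_smul, h1,
    blockFourier, h2]
  congr 1
  ring

lemma h1Weight_mul_norm_fourierCoefficient_sq {f : HilbertBasis (Fin n → ℤ) ℂ (L2 n)}
    (hf : ∀ m, f m = (((√((2 * π) ^ n))⁻¹ : ℝ) : ℂ) • ContinuousMap.toLp 2 volume ℂ (torusMode m))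
    (u : L2 n) (m : Fin n → ℤ) :
    h1Weight m * ‖fourierCoefficient u m‖ ^ 2 =
      ((2 * π) ^ n)⁻¹ * ‖(√(h1Weight m) : ℂ) * f.repr u m‖ ^ 2 := by
  have h2 : ((((2 * π) ^ n : ℝ)) : ℂ)⁻¹ = (((√((2 * π) ^ n))⁻¹ : ℝ) : ℂ) *
      (((√((2 * π) ^ n))⁻¹ : ℝ) : ℂ) := by
    rw [← Complex.ofReal_mul, ← mul_inv, Real.mul_self_sqrt (by positivity), Complex.ofReal_inv]
  have h3 : fourierCoefficient u m = (((√((2 * π) ^ n))⁻¹ : ℝ) : ℂ) * f.repr u m := by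
    rw [f.repr_apply_apply, hf, inner_smul_left, Complex.conj_ofReal, fourierCoefficient, h2,
      mul_assoc]
  have h4 : (√((2 * π) ^ n))⁻¹ ^ 2 = ((2 * π) ^ n)⁻¹ := by
    rw [inv_pow, Real.sq_sqrt (by positivity)]
  rw [h3, norm_mul, norm_mul, Complex.norm_real, Complex.norm_real,
    Real.norm_of_nonneg (by positivity), Real.norm_of_nonneg (Real.sqrt_nonneg _),
    mul_pow (√((2 * π) ^ n))⁻¹, h4, mul_pow (√(h1Weight m)), Real.sq_sqrt (h1Weight_nonneg m)]
  ring

/-- After weighting its coefficients by `(1 + |m|²)^{1/2}`, the operator `P` becomes an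
automorphism of `L²`. -/
lemma exists_equiv_repr_eq_sqrt_h1Weight_mul (hK : 2 ≤ K) {a : Torus n → ℝ} (ha : ∀ x, 0 < a x)
    (w : WindowFamily n K) {f : HilbertBasis (Fin n → ℤ) ℂ (L2 n)}
    (hf : ∀ m,
      f m = (((√((2 * π) ^ n))⁻¹ : ℝ) : ℂ) • ContinuousMap.toLp 2 volume ℂ (torusMode m)) :
    ∃ G : L2 n ≃L[ℂ] L2 n, ∃ P₀ : L2 n →L[ℂ] L2 n, (∀ u, P₀ u = P a w u) ∧
      ∀ u m, f.repr (G u) m = (√(h1Weight m) : ℂ) * f.repr (P₀ u) m := by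
  choose b hb using fun j : Fin n → Fin K => exists_blockBasis hK j
  have hone : ∀ (j : Fin n → Fin K) (x : Fin n → ℝ), 1 ≤ √(1 + a (center j) * ∑ i, x i ^ 2) :=
    fun j x => by
      rw [Real.one_le_sqrt]
      have := mul_nonneg (ha (center j)).le
        (Finset.sum_nonneg fun i (_ : i ∈ Finset.univ) => sq_nonneg (x i))
      linarith
  have hpos : ∀ (j : Fin n → Fin K) (x : Fin n → ℝ), 0 < √(1 + a (center j) * ∑ i, x i ^ 2) :=
    fun j x => one_pos.trans_le (hone j x)
  choose S hS using fun j => (b j).exists_diagonal (C := 1)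
    (fun k => (((√(1 + a (center j) * ∑ i, freq K k i ^ 2))⁻¹ : ℝ) : ℂ)) fun k => by
      rw [Complex.norm_real, Real.norm_of_nonneg (inv_pos.mpr (hpos j _)).le]
      exact inv_le_one_of_one_le₀ (hone j _)
  obtain ⟨G, hG⟩ := exists_equiv_repr_eq_mul_repr f b (sum_norm_windowing_sq w)
    (lam := fun j k => √(1 + a (center j) * ∑ i, freq K k i ^ 2))
    (fun j k => hpos j _) (fun j => tendsto_sqrt_freq hK (ha _))
    (mu := fun j m => √(1 + a (center j) * ∑ i, (m i : ℝ) ^ 2)) (fun j m => hpos j _)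
    (w := fun m => √(h1Weight m))
    (fun m => Real.sqrt_pos.mpr (by unfold h1Weight; positivity))
    (α := fun j => √(a (center j))⁻¹)
    (fun j => Real.sqrt_pos.mpr (inv_pos.mpr (ha _)))
    (fun j => tendsto_sqrt_h1Weight_div (ha _)) hS
    (fun j => exists_clm_symbol_sub hK (ha _).le w j hf (hb j))
  refine ⟨G, ∑ j, (windowing w j).adjoint ∘L S j ∘L windowing w j, fun u => ?_, fun u m => ?_⟩
  · rw [sum_apply, P]
    refine Finset.sum_congr rfl fun j _ => ?_
    rw [blockOperator_eq hK a j (hb j) (hS j) (ha _).le]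
    rfl
  · rw [hG, sum_apply]
    rfl

end WindowedFourier

open WindowedFourier in
theorem propositionf (n K : ℕ) (hK : 2 ≤ K)
    (a : WindowedFourier.Torus n → ℝ) (ha : ∃ C : ℝ, 0 < C ∧ ∀ x, C ≤ a x)
    (w : WindowedFourier.WindowFamily n K) :
    ∃ Φ : WindowedFourier.L2 n ≃ₗ[ℂ] WindowedFourier.H1 n,
      (∀ u, (Φ u : WindowedFourier.L2 n) = WindowedFourier.P a w u) ∧
      ∃ A B : ℝ, 0 < A ∧ A ≤ B ∧
        ∀ u, A * WindowedFourier.h1Norm (Φ u) ≤ ‖u‖ ∧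
          ‖u‖ ≤ B * WindowedFourier.h1Norm (Φ u) := by
  obtain ⟨C, hC, haC⟩ := ha
  obtain ⟨f, hf⟩ := exists_torusBasis n
  obtain ⟨G, P₀, hP₀, hG⟩ :=
    exists_equiv_repr_eq_sqrt_h1Weight_mul hK (fun x => hC.trans_le (haC x)) w hf
  have hsum : ∀ u, HasSum (fun m => h1Weight m * ‖fourierCoefficient (P₀ u) m‖ ^ 2)
      (((2 * π) ^ n)⁻¹ * ‖G u‖ ^ 2) := fun u => by
    refine ((f.hasSum_norm_repr_sq (G u)).mul_left (((2 * π) ^ n)⁻¹)).congr_fun fun m => ?_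
    rw [h1Weight_mul_norm_fourierCoefficient_sq hf, hG]
  have hw : ∀ m : Fin n → ℤ, (√(h1Weight m) : ℂ) ≠ 0 := fun m => by
    have : 0 < √(h1Weight m) := Real.sqrt_pos.mpr (by unfold h1Weight; positivity)
    exact_mod_cast this.ne'
  let Φ₀ : L2 n →ₗ[ℂ] H1 n := P₀.toLinearMap.codRestrict (H1 n) fun u => (hsum u).summable
  have hinj : Function.Injective Φ₀ := by
    rw [injective_iff_map_eq_zero]
    intro u hu
    have h1 : P₀ u = 0 := congrArg Subtype.val hu
    rw [← map_eq_zero_iff G G.injective, ← f.repr.map_eq_zero_iff]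
    ext m
    rw [hG, h1]
    simp
  have hsurj : Function.Surjective Φ₀ := by
    rintro ⟨v, hv⟩
    -- the `L²` function with coefficients `(1 + |m|²)^{1/2} v_m`
    have hmem : Memℓp (fun m => (√(h1Weight m) : ℂ) * f.repr v m) 2 := by
      refine memℓp_gen ?_
      have h1 := (hv : Summable _).mul_left ((2 * π) ^ n)
      refine h1.congr fun m => ?_
      rw [h1Weight_mul_norm_fourierCoefficient_sq hf, mul_inv_cancel_left₀ (by positivity)]
      simp
    refine ⟨G.symm (f.repr.symm ⟨_, hmem⟩), Subtype.ext (f.repr.injective ?_)⟩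
    ext m
    have h1 := hG (G.symm (f.repr.symm ⟨_, hmem⟩)) m
    rw [G.apply_symm_apply, f.repr.apply_symm_apply] at h1
    exact (mul_left_cancel₀ (hw m) h1).symm
  have hbij : Function.Bijective Φ₀ := ⟨hinj, hsurj⟩
  refine ⟨LinearEquiv.ofBijective Φ₀ hbij, hP₀, ?_⟩
  have hnorm : ∀ u, h1Norm (Φ₀ u) = √(((2 * π) ^ n)⁻¹) * ‖G u‖ := fun u => by
    rw [h1Norm]
    change √(∑' m, h1Weight m * ‖fourierCoefficient (P₀ u) m‖ ^ 2) = _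
    rw [(hsum u).tsum_eq, Real.sqrt_mul (by positivity), Real.sqrt_sq (norm_nonneg _)]
  set c := √(((2 * π) ^ n)⁻¹)
  have hc0 : 0 < c := Real.sqrt_pos.mpr (by positivity)
  set g := ‖(G : L2 n →L[ℂ] L2 n)‖ + 1 with hg
  have hg0 : 0 < g := by positivity
  set B := ‖(G.symm : L2 n →L[ℂ] L2 n)‖ / c with hB
  have hA0 : 0 < (c * g)⁻¹ := by positivity
  refine ⟨(c * g)⁻¹, max (c * g)⁻¹ B, hA0, le_max_left _ _, fun u => ?_⟩
  change (c * g)⁻¹ * h1Norm (Φ₀ u) ≤ _ ∧ _ ≤ _ * h1Norm (Φ₀ u)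
  rw [hnorm]
  constructor
  · rw [inv_mul_le_iff₀ (by positivity), mul_assoc]
    refine mul_le_mul_of_nonneg_left ?_ hc0.le
    refine ((G : L2 n →L[ℂ] L2 n).le_opNorm u).trans ?_
    exact mul_le_mul_of_nonneg_right (by linarith) (norm_nonneg _)
  · refine le_trans ?_ (mul_le_mul_of_nonneg_right (le_max_right _ B) (by positivity))
    have h1 := (G.symm : L2 n →L[ℂ] L2 n).le_opNorm (G u)
    rw [ContinuousLinearEquiv.coe_coe, G.symm_apply_apply] at h1
    rw [hB, div_mul_eq_mul_div, mul_left_comm, mul_div_cancel_left₀ _ hc0.ne']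
    exact h1
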